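/- Let $n\ge 4$. For a matrix $A$ write $A>0$ if all its entries are positive; a nonnegative square matrix $A$ is primitive if $A^m>0$ for some $m\ge1$, and then $\exp(A)$ is the least such $m$. Let $\mathcal{PSC}_n^{1,0}$ be the set of primitive matrices of the form $A+A^T$, where $A$ is an $n\times n$ companion matrix (ones on the superdiagonal, zeros elsewhere in the first $n-1$ rows) whose last row is a $0$-$1$ vector starting with $1$ and ending with $0$. The last row of a matrix in $\mathcal{PSC}_n^{1,0}$ is $[1,Y,1,0]$ or $[1,Y,2,0]$ with a binary string $Y$ of length $n-3$. Let $\mathcal{PSC}_{n,k}^{1,0}$ be the set of those whose string $Y$ has longest zero run of length exactly $k$. Let $E(X)$ be the set of exponents of the primitive matrices in a set $X$ of matrices, let $S_n^{1,0}(b)=\{k : b\in E(\mathcal{PSC}_{n,k}^{1,0})\}$, let $N_n^{1,0}(b)$ be the number of matrices in $\mathcal{PSC}_n^{1,0}$ with exponent $b$, and let $F_m(q,k)$ be the number of binary strings of length $m$ with exactly $q$ zeros and longest zero run of length exactly $k$. Intervals $[x,y]$ consist of the positive integers $k$ with $x\le k\le y$. Let $b\in E(\mathcal{PSC}_n^{1,0})\setminus\{2\}$.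 Then $S_n^{1,0}(b)\subseteq[\frac{b-4}{2},b-2]$ and $$N_n^{1,0}(b)\le 2\sum_{k\in S_n^{1,0}(b)}\ \sum_{q=k}^{n-3}F_{n-3}(q,k).$$ Moreover: 1. $b-2\in S_n^{1,0}(b)$. 2. If $n$ is odd and $b+5\le n\le 2b-5$, then $S_n^{1,0}(b)=[\frac{b-4}{2},b-2]\setminus\{b-4\}$. 3. Let $n$ be even and $k\in[\frac{b-4}{2},b-2]$. If $k\le\lfloor\frac{n+1}{3}\rfloor-2$, then $k\in S_n^{1,0}(b)$. If $k\ge\lfloor\frac{n+1}{3}\rfloor-1$, then: (a) if $k$ is odd, then $k\in S_n^{1,0}(b)$ if and only if $b\le l$, where, with $d=n-k-4$ (a positive odd integer in this case), $l=k+2\lfloor d/4\rfloor+3$ if $d\equiv1\pmod 4$ and $l=k+2\lfloor d/4\rfloor+5$ if $d\equiv 3\pmod 4$; (b) if $k$ is even, then $k\in S_n^{1,0}(b)$ if and only if $k=b-2$, or $k\le n-b$ and $2k+4\le n\le 3k+2$, or $n=3k+4$ and $b\le\frac{2(n-1)}{3}$. -/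

import Mathlib

namespace SymCompanion

/-- The `n × n` companion matrix whose first `n - 1` rows carry the shift and whose last row is
the binary vector `a`. -/
def companion {n : ℕ} (a : Fin n → Fin 2) : Matrix (Fin n) (Fin n) ℝ :=
  Matrix.of fun i j =>
    if (i : ℕ) + 1 = n then ((a j : ℕ) : ℝ)
    else if (j : ℕ) = (i : ℕ) + 1 then 1 else 0

/-- `C n` is the set of all `(0,1)` companion matrices of order `n`. -/
def C (n : ℕ) : Set (Matrix (Fin n) (Fin n) ℝ) :=
  {A | ∃ a : Fin n → Fin 2, A = companion a}

/-- `F A = A + Aᵀ`. -/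
def F {n : ℕ} (A : Matrix (Fin n) (Fin n) ℝ) : Matrix (Fin n) (Fin n) ℝ :=
  A + A.transpose

/-- The symmetric companion matrices `F A` of order `n` for which the last row of `A` starts
with `α` and ends with `e`. -/
def SC (n : ℕ) (α e : Fin 2) : Set (Matrix (Fin n) (Fin n) ℝ) :=
  {B | ∃ A ∈ C n, ∃ h : 0 < n,
    A ⟨n - 1, Nat.sub_lt h Nat.one_pos⟩ ⟨0, h⟩ = ((α : ℕ) : ℝ) ∧
    A ⟨n - 1, Nat.sub_lt h Nat.one_pos⟩ ⟨n - 1, Nat.sub_lt h Nat.one_pos⟩ = ((e : ℕ) : ℝ) ∧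
    B = F A}

/-- The primitive matrices among `SC n α e`. -/
def PSC (n : ℕ) (α e : Fin 2) : Set (Matrix (Fin n) (Fin n) ℝ) :=
  {B | B ∈ SC n α e ∧ B.IsPrimitive}

/-- The exponent of a primitive matrix: the least positive `k` such that all entries of `A ^ k`
are positive. -/
noncomputable def exponent {n : ℕ} (A : Matrix (Fin n) (Fin n) ℝ) : ℕ :=
  sInf {k : ℕ | 0 < k ∧ ∀ i j, 0 < (A ^ k) i j}

/-- The exponent set of a set of matrices. -/
def exponentSet {n : ℕ} (X : Set (Matrix (Fin n) (Fin n) ℝ)) : Set ℕ :=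
  {k | ∃ A ∈ X, A.IsPrimitive ∧ exponent A = k}

/-- The binary string `Y` has a subword consisting of `l` consecutive zeros. -/
def HasZeroRun {m : ℕ} (Y : Fin m → Fin 2) (l : ℕ) : Prop :=
  ∃ s : ℕ, s + l ≤ m ∧ ∀ i : Fin m, s ≤ (i : ℕ) → (i : ℕ) < s + l → Y i = 0

/-- Binary strings of length `m` with exactly `q` zeros whose longest subwords of zeros have
length `k`. -/
def BinStr (m q k : ℕ) : Set (Fin m → Fin 2) :=
  {Y | {i : Fin m | Y i = 0}.ncard = q ∧ IsGreatest {l : ℕ | HasZeroRun Y l} k}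

/-- The string `Y` fills the positions `2, …, n - 2` of the last row of `A`, that is, the
last row of `A` is `[*, Y, *, *]`. -/
def HasString {n : ℕ} (A : Matrix (Fin n) (Fin n) ℝ) (Y : Fin (n - 3) → Fin 2) : Prop :=
  ∀ i : Fin (n - 3),
    A ⟨n - 1, by have := i.isLt; omega⟩ ⟨(i : ℕ) + 1, by have := i.isLt; omega⟩ =
      ((Y i : ℕ) : ℝ)

/-- The matrices of `PSC n 1 0` whose string has longest zero runs of length `k`. -/
def PSCRun (n k : ℕ) : Set (Matrix (Fin n) (Fin n) ℝ) :=
  {A | A ∈ PSC n 1 0 ∧ ∃ Y : Fin (n - 3) → Fin 2, HasString A Y ∧ ∃ q : ℕ, Y ∈ BinStr (n - 3) q k}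

/-- The admissible zero-run lengths for the exponent `b`. -/
def S (n b : ℕ) : Set ℕ :=
  {k | b ∈ exponentSet (PSCRun n k)}

/-- The number of matrices in `PSC n 1 0` with exponent `b`. -/
noncomputable def N (n b : ℕ) : ℕ :=
  {A | A ∈ PSC n 1 0 ∧ exponent A = b}.ncard

/-- The bound `l`, for `k` odd and `n` even with `k + 5 ≤ n` (so that `n - k - 4` is odd,
hence `1` or `3` modulo `4`). -/
def ell (n k : ℕ) : ℕ :=
  if n - k - 4 = 4 * ((n - k - 4) / 4) + 1 then k + 2 * ((n - k - 4) / 4) + 3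
  else k + 2 * ((n - k - 4) / 4) + 5

end SymCompanion

namespace SymCompanion

/-! Read the matrix as a graph: a path on `0, …, n - 1` whose last vertex, the hub, is joined to a
set `p` of path vertices containing `0` and `n - 2`. Entries of powers are positive exactly when
walks exist. The points of `p` cut `0, …, n - 2` into gaps, and a gap of length g closes a cycle of
length g + 2 through the hub. Primitivity means that some gap is odd; let o be the least odd gap
length.

The exponent is the maximum over gaps of g + 1 for odd g, and for even g of g + o + 1 or g + o + 3,
according to whether a gap of length o touches the gap (`primitive_and_exponent`). Upper bound,
`IsFan.walk_of_upperCond`: go to the hub by either end of the gap, correct parity by an odd cycle,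
and pad by going back and forth. Lower bound, `IsFan.lower_bound`: a vertex in the middle of a
critical gap lies on no short odd closed walk.

A longest zero run k is a longest gap k + 1, so `mem_S_iff` turns the theorem into a question on
lists of gap lengths with sum n - 2. When n is even the odd gaps are even in number, so a second gap
of length at least o must fit; the thresholds come from this. Necessity counts room on the path;
sufficiency uses explicit lists, padded by gaps of length 1 or 2. -/

/-- Adjacency in the graph on `0, …, n - 1` that consists of the path `0, 1, …, n - 1` and the
edges between the hub `n - 1` and the vertices satisfying `p`. -/
def Step (n : ℕ) (p : ℕ → Prop) (x y : ℕ) : Prop :=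
  x + 1 = y ∨ y + 1 = x ∨ (x + 1 = n ∧ p y) ∨ (y + 1 = n ∧ p x)

/-- `Walk n p m x y`: there is a walk of length `m` from `x` to `y`. -/
inductive Walk (n : ℕ) (p : ℕ → Prop) : ℕ → ℕ → ℕ → Prop
  | nil (x : ℕ) : x < n → Walk n p 0 x x
  | snoc {m x y z : ℕ} : Walk n p m x y → z < n → Step n p y z → Walk n p (m + 1) x z

/-- The neighbours of the hub lie on the path `0, …, n - 2` and include both of its ends. -/
structure IsFan (n : ℕ) (p : ℕ → Prop) : Prop where
  three_le : 3 ≤ n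
  zero : p 0
  last : p (n - 2)
  le : ∀ y, p y → y + 2 ≤ n

/-- `i < j` are consecutive points of `p`. -/
def IsGap (p : ℕ → Prop) (i j : ℕ) : Prop :=
  i < j ∧ p i ∧ p j ∧ ∀ z, i < z → z < j → ¬ p z

/-- `o` is the least odd length of a gap of `p`. -/
def IsMinOdd (p : ℕ → Prop) (o : ℕ) : Prop :=
  o % 2 = 1 ∧ (∃ i, IsGap p i (i + o)) ∧ ∀ i j, IsGap p i j → (i + j) % 2 = 1 → i + o ≤ j

/-- A gap of length `o` ends at `i` or starts at `j`. -/
def Adjacent (p : ℕ → Prop) (o i j : ℕ) : Prop :=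
  ∃ a, (IsGap p a i ∧ a + o = i) ∨ (IsGap p j a ∧ j + o = a)

/-- The conditions on the gaps of `p` under which any two vertices are joined by a walk of
the even length `b`. -/
def UpperCond (p : ℕ → Prop) (o b : ℕ) : Prop :=
  (∀ i j, IsGap p i j → (i + j) % 2 = 1 → j + 1 ≤ i + b) ∧
  ∀ i j, IsGap p i j → (i + j) % 2 = 0 →
    j + o + 3 ≤ i + b ∨ (j + o + 1 ≤ i + b ∧ Adjacent p o i j)

/-- Some gap of `p` attains the bound of `UpperCond`. -/
def LowerCond (p : ℕ → Prop) (o b : ℕ) : Prop :=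
  ∃ i j, IsGap p i j ∧ (((i + j) % 2 = 1 ∧ j + 1 = i + b) ∨
    ((i + j) % 2 = 0 ∧ ((j + o + 3 = i + b ∧ ¬ Adjacent p o i j) ∨ j + o + 1 = i + b)))

/-- The description of the exponent in terms of gaps. -/
def HasExp (p : ℕ → Prop) (b : ℕ) : Prop :=
  ∃ o, IsMinOdd p o ∧ UpperCond p o b ∧ LowerCond p o b

/-! ### Gaps -/

section Gaps

variable {n : ℕ} {p : ℕ → Prop}

theorem exists_gap_of_between {a z c : ℕ} (ha : p a) (hc : p c) (haz : a ≤ z) (hzc : z < c) :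
    ∃ i j, IsGap p i j ∧ a ≤ i ∧ i ≤ z ∧ z < j ∧ j ≤ c := by
  classical
  have h1 : ∃ d, p (z - d) ∧ d ≤ z := ⟨z - a, by rwa [Nat.sub_sub_self haz], by omega⟩
  have h2 : ∃ d, p (z + 1 + d) := ⟨c - z - 1, by rwa [show z + 1 + (c - z - 1) = c by omega]⟩
  have e1 : Nat.find h1 ≤ z - a :=
    Nat.find_min' h1 ⟨by rwa [Nat.sub_sub_self haz], by omega⟩
  have e2 : Nat.find h2 ≤ c - z - 1 :=
    Nat.find_min' h2 (by rwa [show z + 1 + (c - z - 1) = c by omega])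
  refine ⟨z - Nat.find h1, z + 1 + Nat.find h2,
    ⟨by omega, (Nat.find_spec h1).1, Nat.find_spec h2, ?_⟩, by omega, by omega, by omega, by omega⟩
  intro y hy1 hy2 hy
  by_cases hyz : y ≤ z
  · exact Nat.find_min h1 (m := z - y) (by omega) ⟨by rwa [Nat.sub_sub_self hyz], by omega⟩
  · exact Nat.find_min h2 (m := y - z - 1) (by omega)
      (by rwa [show z + 1 + (y - z - 1) = y by omega])

theorem exists_gap_right {a c : ℕ} (ha : p a) (hc : p c) (h : a < c) :
    ∃ j, IsGap p a j ∧ j ≤ c := by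
  obtain ⟨i, j, hg, h1, h2, -, h4⟩ := exists_gap_of_between ha hc le_rfl h
  obtain rfl : i = a := by omega
  exact ⟨j, hg, h4⟩

theorem exists_gap_left {a c : ℕ} (ha : p a) (hc : p c) (h : a < c) :
    ∃ i, IsGap p i c ∧ a ≤ i := by
  obtain ⟨i, j, hg, h1, h2, h3, h4⟩ :=
    exists_gap_of_between ha hc (z := c - 1) (by omega) (by omega)
  obtain rfl : j = c := by omega
  exact ⟨i, hg, h1⟩

theorem exists_odd_gap {a c : ℕ} (ha : p a) (hc : p c) (h : a < c) (hodd : (a + c) % 2 = 1) :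
    ∃ i j, IsGap p i j ∧ (i + j) % 2 = 1 ∧ a ≤ i ∧ j ≤ c := by
  induction hd : c - a using Nat.strong_induction_on generalizing a with
  | _ d ih =>
    obtain ⟨j, hg, hj⟩ := exists_gap_right ha hc h
    by_cases hp : (a + j) % 2 = 1
    · exact ⟨a, j, hg, hp, le_rfl, hj⟩
    · have := hg.1
      obtain ⟨i, l, h1, h2, h3, h4⟩ :=
        ih (c - j) (by omega) hg.2.2.1 (by omega) (by omega) rfl
      exact ⟨i, l, h1, h2, by omega, h4⟩

theorem IsGap.disjoint {i j i' j' : ℕ} (h : IsGap p i j) (h' : IsGap p i' j') :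
    (i = i' ∧ j = j') ∨ j ≤ i' ∨ j' ≤ i := by
  obtain ⟨a1, a2, a3, a4⟩ := h
  obtain ⟨b1, b2, b3, b4⟩ := h'
  by_contra hc
  push Not at hc
  have c1 : ¬ (i < i') := fun q => a4 i' q (by omega) b2
  have c2 : ¬ (i' < i) := fun q => b4 i q (by omega) a2
  have c3 : ¬ (j' < j) := fun q => a4 j' (by omega) q b3
  have c4 : ¬ (j < j') := fun q => b4 j (by omega) q a3
  omega

theorem IsMinOdd.le_of_odd {o a c : ℕ} (ho : IsMinOdd p o) (ha : p a) (hc : p c) (h : a < c)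
    (hodd : (a + c) % 2 = 1) : a + o ≤ c := by
  obtain ⟨i, j, h1, h2, h3, h4⟩ := exists_odd_gap ha hc h hodd
  have := ho.2.2 i j h1 h2
  omega

theorem exists_isMinOdd {i j : ℕ} (hg : IsGap p i j) (hodd : (i + j) % 2 = 1) :
    ∃ o, IsMinOdd p o := by
  classical
  have hex : ∃ o, o % 2 = 1 ∧ ∃ i, IsGap p i (i + o) :=
    ⟨j - i, by have := hg.1; omega, i, by rwa [show i + (j - i) = j by have := hg.1; omega]⟩
  refine ⟨Nat.find hex, (Nat.find_spec hex).1, (Nat.find_spec hex).2, fun i j h ho => ?_⟩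
  have := hg.1
  have h1 := h.1
  have := Nat.find_min' hex (m := j - i) ⟨by omega, i, by rwa [show i + (j - i) = j by omega]⟩
  omega

/-- All bounds contributed by gaps are even, so at the least even number satisfying `UpperCond` some
gap must be tight. -/
theorem exists_hasExp {i j : ℕ} (hf : IsFan n p) (hg : IsGap p i j) (hodd : (i + j) % 2 = 1) :
    ∃ b, HasExp p b := by
  classical
  obtain ⟨o, ho⟩ := exists_isMinOdd hg hodd
  have hex : ∃ c, UpperCond p o (2 * c) := by
    refine ⟨n + o + 3, fun i j h _ => ?_, fun i j h _ => Or.inl ?_⟩ <;>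
    · have := hf.le j h.2.2.1
      omega
  have hs := Nat.find_spec hex
  have hm := fun c => Nat.find_min hex (m := c)
  set c := Nat.find hex
  have h0 := hs.1 i j hg hodd
  have hij := hg.1
  have hlt : ¬ UpperCond p o (2 * (c - 1)) := hm (c - 1) (by omega)
  refine ⟨2 * c, o, ho, hs, ?_⟩
  have ho1 := ho.1
  by_contra hL
  apply hlt
  refine ⟨fun i j h hp => ?_, fun i j h hp => ?_⟩
  · by_contra hc
    have := hs.1 i j h hp
    exact hL ⟨i, j, h, Or.inl ⟨hp, by omega⟩⟩
  · by_contra hc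
    rw [not_or, not_and] at hc
    rcases hs.2 i j h hp with h1 | ⟨h1, h2⟩
    · have h3 : ¬ Adjacent p o i j := fun h3 => hc.2 (by omega) h3
      exact hL ⟨i, j, h, Or.inr ⟨hp, Or.inl ⟨by omega, h3⟩⟩⟩
    · have h3 : ¬ (j + o + 1 ≤ i + 2 * (c - 1)) := fun h3 => hc.2 h3 h2
      exact hL ⟨i, j, h, Or.inr ⟨hp, Or.inr (by omega)⟩⟩

theorem HasExp.even {b : ℕ} (h : HasExp p b) : b % 2 = 0 := by
  obtain ⟨o, ⟨ho, -, -⟩, -, i, j, -, h⟩ := h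
  omega

end Gaps

/-! ### Walks -/

section Walks

variable {n : ℕ} {p : ℕ → Prop}

theorem Step.symm {x y : ℕ} (h : Step n p x y) : Step n p y x := by
  unfold Step at *
  tauto

theorem Walk.lt_right {m x y : ℕ} (h : Walk n p m x y) : y < n := by
  cases h with
  | nil _ hx => exact hx
  | snoc _ hz _ => exact hz

theorem Walk.trans {m m' x y z : ℕ} (h : Walk n p m x y) (h' : Walk n p m' y z) :
    Walk n p (m + m') x z := by
  induction h' with
  | nil => exact h
  | snoc _ hz hs ih => exact Walk.snoc (ih h) hz hs

theorem Walk.symm {m x y : ℕ} (h : Walk n p m x y) : Walk n p m y x := by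
  induction h with
  | nil x hx => exact Walk.nil x hx
  | @snoc m x y z hw hz hs ih =>
    have := (Walk.snoc (Walk.nil z hz) hw.lt_right hs.symm).trans ih
    rwa [show 0 + 1 + m = m + 1 by omega] at this

theorem Walk.of_le {x d : ℕ} (h : x + d < n) : Walk n p d x (x + d) := by
  induction d with
  | zero => exact Walk.nil x h
  | succ d ih => exact Walk.snoc (ih (by omega)) h (Or.inl rfl)

theorem Walk.add_two {m x y : ℕ} (hn : 2 ≤ n) (h : Walk n p m x y) : Walk n p (m + 2) x y := by
  have hy := h.lt_right
  by_cases h1 : y + 1 < n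
  · exact Walk.snoc (Walk.snoc h h1 (Or.inl rfl)) hy (Or.inr (Or.inl rfl))
  · obtain ⟨z, rfl⟩ : ∃ z, y = z + 1 := ⟨y - 1, by omega⟩
    exact Walk.snoc (Walk.snoc h (by omega : z < n) (Or.inr (Or.inl rfl))) hy (Or.inl rfl)

theorem Walk.mono {m m' x y : ℕ} (hn : 2 ≤ n) (h : Walk n p m x y) (hle : m ≤ m')
    (hpar : (m + m') % 2 = 0) : Walk n p m' x y := by
  obtain ⟨d, rfl⟩ : ∃ d, m' = m + 2 * d := ⟨(m' - m) / 2, by omega⟩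
  clear hle hpar
  induction d with
  | zero => exact h
  | succ d ih => exact ih.add_two hn

/-! ### Walks through the hub: the upper bound -/

theorem IsFan.walk_hub_right {x i s : ℕ} (hf : IsFan n p) (hi : p i) (h : x + s = i) :
    Walk n p (s + 1) x (n - 1) := by
  subst h
  have := hf.le _ hi
  exact Walk.snoc (Walk.of_le (by omega)) (by omega) (Or.inr (Or.inr (Or.inr ⟨by omega, hi⟩)))

theorem IsFan.walk_hub_left {x i s : ℕ} (hf : IsFan n p) (hx : x < n) (hi : p i) (h : i + s = x) :
    Walk n p (s + 1) x (n - 1) := by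
  subst h
  have := hf.le _ hi
  exact Walk.snoc (Walk.of_le (by omega)).symm (by omega)
    (Or.inr (Or.inr (Or.inr ⟨by omega, hi⟩)))

theorem IsFan.walk_hub_hub {o : ℕ} (hf : IsFan n p) (ho : IsMinOdd p o) :
    Walk n p (o + 2) (n - 1) (n - 1) := by
  obtain ⟨-, ⟨i, -, h1, h2, -⟩, -⟩ := ho
  have := hf.le _ h1
  have a := hf.walk_hub_left (by omega) h1 (show i + 0 = i by omega)
  have b := hf.walk_hub_right h2 (show i + o = i + o from rfl)
  have := a.symm.trans b
  rwa [show 0 + 1 + (o + 1) = o + 2 by omega] at this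

/-- Here s and t are the distances from x to the two ends of its gap. In an odd gap the two routes
to the hub have opposite parity; in an even gap the other parity costs a detour round a shortest odd
cycle, or a walk across a touching gap of length o, which saves 2. -/
theorem IsFan.hub_profile {o b x : ℕ} (hf : IsFan n p) (hU : UpperCond p o b)
    (hx : x + 1 < n) :
    ∃ s t, Walk n p (s + 1) x (n - 1) ∧ Walk n p (t + 1) x (n - 1) ∧
      (((s + t) % 2 = 1 ∧ s + t + 1 ≤ b) ∨
       ((s + t) % 2 = 0 ∧ s ≤ t ∧ 2 ≤ s + t ∧ (s + t + o + 3 ≤ b ∨ (s + t + o + 1 ≤ b ∧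
          (Walk n p (s + o + 1) x (n - 1) ∨ Walk n p (t + o + 1) x (n - 1)))))) := by
  have hgap : ∃ i j, IsGap p i j ∧ i ≤ x ∧ x ≤ j := by
    rcases Nat.lt_or_ge x (n - 2) with h | h
    · obtain ⟨i, j, hg, h1, h2, h3, h4⟩ := exists_gap_of_between hf.zero hf.last (Nat.zero_le x) h
      exact ⟨i, j, hg, h2, by omega⟩
    · obtain rfl : x = n - 2 := by omega
      have := hf.three_le
      obtain ⟨i, hg, h1⟩ := exists_gap_left hf.zero hf.last (by omega)
      exact ⟨i, n - 2, hg, hg.1.le, le_rfl⟩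
  obtain ⟨i, j, hg, hix, hxj⟩ := hgap
  obtain ⟨s, rfl⟩ := Nat.exists_eq_add_of_le hix
  obtain ⟨t, rfl⟩ := Nat.exists_eq_add_of_le hxj
  have hs := hf.walk_hub_left (show i + s < n by omega) hg.2.1 rfl
  have ht := hf.walk_hub_right hg.2.2.1 rfl
  have hlt := hg.1
  by_cases hpar : (s + t) % 2 = 1
  · have := hU.1 _ _ hg (by omega)
    exact ⟨s, t, hs, ht, Or.inl ⟨hpar, by omega⟩⟩
  have key : s + t + o + 3 ≤ b ∨ (s + t + o + 1 ≤ b ∧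
      (Walk n p (s + o + 1) (i + s) (n - 1) ∨ Walk n p (t + o + 1) (i + s) (n - 1))) := by
    rcases hU.2 _ _ hg (by omega) with h | ⟨h, a, ⟨ha, rfl⟩ | ⟨ha, rfl⟩⟩
    · left; omega
    · right
      refine ⟨by omega, Or.inl ?_⟩
      exact hf.walk_hub_left (by omega) ha.2.1 (by omega)
    · right
      refine ⟨by omega, Or.inr ?_⟩
      exact hf.walk_hub_right ha.2.2.1 (by omega)
  rcases Nat.le_total s t with h | h
  · exact ⟨s, t, hs, ht, Or.inr ⟨by omega, h, by omega, key⟩⟩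
  · refine ⟨t, s, ht, hs, Or.inr ⟨by omega, h, by omega, ?_⟩⟩
    rw [Nat.add_comm t s]
    exact key.imp id (And.imp id Or.symm)

theorem IsFan.walk_of_upperCond {o b x y : ℕ} (hf : IsFan n p) (ho : IsMinOdd p o)
    (hU : UpperCond p o b) (hb : b % 2 = 0) (hx : x < n) (hy : y < n) : Walk n p b x y := by
  have hn : 2 ≤ n := by have := hf.three_le; omega
  have ho1 := ho.1
  have hh := hf.walk_hub_hub ho
  have nil : Walk n p 0 (n - 1) (n - 1) := Walk.nil _ (by omega)
  have hub : ∀ {m y}, Walk n p m y (n - 1) → m ≤ b → m % 2 = 0 → Walk n p b (n - 1) y :=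
    fun h h1 h2 => h.symm.mono hn h1 (by omega)
  have hubmain : ∀ y, y < n → Walk n p b (n - 1) y := by
    intro y hy
    by_cases hyh : y = n - 1
    · subst hyh; exact nil.mono hn (by omega) (by omega)
    obtain ⟨s, t, hs, ht, ⟨h1, h2⟩ | ⟨h1, h2, h3, h4⟩⟩ := hf.hub_profile (x := y) hU (by omega)
    · by_cases hp : s % 2 = 1
      · exact hub hs (by omega) (by omega)
      · exact hub ht (by omega) (by omega)
    · by_cases hp : s % 2 = 1
      · exact hub hs (by omega) (by omega)
      · exact hub (hs.trans hh) (by omega) (by omega)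
  by_cases hxh : x = n - 1
  · subst hxh; exact hubmain y hy
  by_cases hyh : y = n - 1
  · subst hyh; exact (hubmain x hx).symm
  have via : ∀ {m m'}, Walk n p m x (n - 1) → Walk n p m' y (n - 1) → m + m' ≤ b →
      (m + m') % 2 = 0 → Walk n p b x y :=
    fun h h' h1 h2 => (h.trans h'.symm).mono hn h1 (by omega)
  obtain ⟨s, t, hs, ht, hc⟩ := hf.hub_profile (x := x) hU (by omega)
  obtain ⟨s', t', hs', ht', hc'⟩ := hf.hub_profile (x := y) hU (by omega)
  rcases hc with ⟨h1, h2⟩ | ⟨h1, h2, h3, h4⟩ <;> rcases hc' with ⟨h1', h2'⟩ | ⟨h1', h2', h3', h4'⟩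
  · rcases Nat.mod_two_eq_zero_or_one (s + s') with hp | hp
    -- The two complementary routes have total length at most 2b + 2, and both are even, so one of
    -- them has length at most b.
    · by_cases hle : s + s' + 2 ≤ b
      · exact via hs hs' (by omega) (by omega)
      · exact via ht ht' (by omega) (by omega)
    · by_cases hle : s + t' + 2 ≤ b
      · exact via hs ht' (by omega) (by omega)
      · exact via ht hs' (by omega) (by omega)
  · have : ∀ u v, Walk n p (u + 1) x (n - 1) → Walk n p (v + 1) x (n - 1) → u + v = s + t →
        (u + s') % 2 = 0 → Walk n p b x y := by
      intro u v hu hv huv hp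
      by_cases c1 : u + s' + 2 ≤ b
      · exact via hu hs' (by omega) (by omega)
      by_cases c2 : v + s' + o + 4 ≤ b
      · exact via hv (hs'.trans hh) (by omega) (by omega)
      rcases h4' with h5 | ⟨h5, h6 | h6⟩
      · omega
      · exact via hv h6 (by omega) (by omega)
      · exact via hv h6 (by omega) (by omega)
    by_cases hp : (s + s') % 2 = 0
    · exact this s t hs ht rfl hp
    · exact this t s ht hs (by omega) (by omega)
  · have : ∀ u v, Walk n p (u + 1) y (n - 1) → Walk n p (v + 1) y (n - 1) → u + v = s' + t' →
        (u + s) % 2 = 0 → Walk n p b x y := by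
      intro u v hu hv huv hp
      by_cases c1 : u + s + 2 ≤ b
      · exact via hs hu (by omega) (by omega)
      by_cases c2 : v + s + o + 4 ≤ b
      · exact via (hs.trans hh) hv (by omega) (by omega)
      rcases h4 with h5 | ⟨h5, h6 | h6⟩
      · omega
      · exact via h6 hv (by omega) (by omega)
      · exact via h6 hv (by omega) (by omega)
    by_cases hp : (s' + s) % 2 = 0
    · exact this s' t' hs' ht' rfl hp
    · exact this t' s' ht' hs' (by omega) (by omega)
  · by_cases hp : (s + s') % 2 = 0
    · exact via hs hs' (by omega) (by omega)
    by_cases c1 : s + s' + o + 4 ≤ b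
    · exact via (hs.trans hh) hs' (by omega) (by omega)
    -- The parity detour is charged to the endpoint whose nearer gap end is farther away.
    rcases Nat.lt_or_ge s s' with hlt | hge
    · rcases h4' with h5 | ⟨h5, h6 | h6⟩
      · omega
      · exact via hs h6 (by omega) (by omega)
      · exact via hs h6 (by omega) (by omega)
    · rcases h4 with h5 | ⟨h5, h6 | h6⟩
      · omega
      · exact via h6 hs' (by omega) (by omega)
      · exact via h6 hs' (by omega) (by omega)

/-- Lower bound for the length of a closed walk of odd length, by following the walk since its last
visit to the hub. -/
theorem IsFan.le_of_odd_closed_walk {x e w m : ℕ} (hf : IsFan n p) (hx : x + 1 < n)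
    (h1 : ∀ a c, p a → p c → a < c → (a + c) % 2 = 1 → a + w ≤ c + 2)
    (h2 : ∀ y, p y → (x + e ≤ y ∨ y + e ≤ x) ∧
      ((x + y + e) % 2 = 1 → x + e + w ≤ y ∨ y + e + w ≤ x))
    (hw : Walk n p m x x) (hm : m % 2 = 1) : 2 * e + w + 2 ≤ m := by
  -- At the hub, either the length has the parity of e + 1, or the surcharge w has already been
  -- paid. Away from it, either the hub is still unvisited or `i` is the point by which it was last
  -- left.
  have inv : ∀ {m y}, Walk n p m x y →
      (y = n - 1 → ((m + e + 1) % 2 = 0 ∧ e + 1 ≤ m) ∨ e + w + 1 ≤ m) ∧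
      (y ≠ n - 1 → ((m + x + y) % 2 = 0 ∧ x ≤ y + m ∧ y ≤ x + m) ∨
        ∃ i, p i ∧ (((m + e + y + i) % 2 = 0 ∧ e + 2 + i ≤ y + m ∧ e + 2 + y ≤ i + m) ∨
          (e + w + 2 + i ≤ y + m ∧ e + w + 2 + y ≤ i + m))) := by
    intro m y h
    generalize hx' : x = x' at h
    induction h with
    | nil x hx =>
      subst hx'
      exact ⟨fun h => by omega, fun _ => Or.inl (by omega)⟩
    | @snoc m x₀ y z hw hz hs ih =>
      subst hx'
      obtain ⟨ih1, ih2⟩ := ih rfl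
      have hy := hw.lt_right
      have hph : ¬ p (n - 1) := fun h => by have := hf.le _ h; omega
      constructor
      · rintro rfl
        have hpy : p y := by
          rcases hs with h | h | ⟨h, h'⟩ | ⟨h, h'⟩
          · have := hf.last
            rwa [show n - 2 = y by omega] at this
          · omega
          · exact absurd h' hph
          · exact h'
        have hyn := hf.le y hpy
        rcases ih2 (by omega) with h | ⟨i, hi, h⟩
        · have := h2 y hpy
          omega
        · have a1 := h1 y i hpy hi
          have a2 := h1 i y hi hpy
          omega
      · intro hzn
        by_cases hyn : y = n - 1
        · have hpz : p z := by
            rcases hs with h | h | ⟨h, h'⟩ | ⟨h, h'⟩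
            · omega
            · have := hf.last
              rwa [show n - 2 = z by omega] at this
            · exact h'
            · omega
          right
          refine ⟨z, hpz, ?_⟩
          have := ih1 hyn
          omega
        · have hyz : y + 1 = z ∨ z + 1 = y := by
            rcases hs with h | h | ⟨h, h'⟩ | ⟨h, h'⟩ <;> omega
          rcases ih2 hyn with h | ⟨i, hi, h⟩
          · left; omega
          · right
            exact ⟨i, hi, by omega⟩
  rcases (inv hw).2 (by omega) with h | ⟨i, hi, h⟩
  · omega
  · have := h2 i hi
    omega

/-- Without odd gaps the parity hypotheses of `IsFan.le_of_odd_closed_walk` are vacuous, so w may be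
as large as m, which is absurd. -/
theorem IsFan.exists_odd_gap_of_walk {m : ℕ} (hf : IsFan n p) (hm : m % 2 = 1)
    (hw : Walk n p m 0 0) : ∃ i j, IsGap p i j ∧ (i + j) % 2 = 1 := by
  by_contra hc
  have hev : ∀ a c, p a → p c → a < c → (a + c) % 2 ≠ 1 := fun a c ha hc' h ho => by
    obtain ⟨i, j, h1, h2, -⟩ := exists_odd_gap ha hc' h ho
    exact hc ⟨i, j, h1, h2⟩
  have := hf.three_le
  have := hf.le_of_odd_closed_walk (x := 0) (e := 0) (w := m) (by omega)
    (fun a c ha hc' h ho => absurd ho (hev a c ha hc' h))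
    (fun y hy => ⟨by omega, fun ho => absurd (by omega) (hev 0 y hf.zero hy (by omega))⟩) hw hm
  omega

theorem IsFan.lower_bound {o b : ℕ} (hf : IsFan n p) (ho : IsMinOdd p o)
    (hL : LowerCond p o b) :
    ∃ x < n, ∀ m, m % 2 = 1 → Walk n p m x x → b + 1 ≤ m := by
  obtain ⟨i, j, hg, h⟩ := hL
  have ho1 := ho.1
  have hlt := hg.1
  have hjn := hf.le j hg.2.2.1
  have hout : ∀ y, p y → y ≤ i ∨ j ≤ y := fun y hy => by
    by_contra hc
    exact hg.2.2.2 y (by omega) (by omega) hy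
  have hmin := fun a c ha hc h => IsMinOdd.le_of_odd (p := p) (a := a) (c := c) ho ha hc h
  rcases h with ⟨hp, hb⟩ | ⟨hp, ⟨hb, hna⟩ | hb⟩
  · refine ⟨i + (j - i - 1) / 2, by omega, fun m hm hw => ?_⟩
    have := hf.le_of_odd_closed_walk (e := (j - i - 1) / 2) (w := 1) (by omega)
      (fun a c _ _ _ _ => by omega)
      (fun y hy => by have := hout y hy; omega) hw hm
    omega
  · refine ⟨i + (j - i) / 2, by omega, fun m hm hw => ?_⟩
    -- As no gap of length o touches this one, points of `p` of the wrong parity lie at least o + 2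
    -- beyond its ends; this gives w = o + 2 instead of o.
    have hleft : ∀ y, p y → y < i → (y + i) % 2 = 1 → y + o + 2 ≤ i := by
      intro y hy hyi hyo
      obtain ⟨a, hga, hya⟩ := exists_gap_left hy hg.2.1 hyi
      have hai := hga.1
      rcases Nat.mod_two_eq_zero_or_one (a + i) with h0 | h0
      · have := hmin y a hy hga.2.1 (by omega) (by omega)
        omega
      · have := ho.2.2 a i hga h0
        have : a + o ≠ i := fun h => hna ⟨a, Or.inl ⟨hga, h⟩⟩
        omega
    have hright : ∀ y, p y → j < y → (y + j) % 2 = 1 → j + o + 2 ≤ y := by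
      intro y hy hyi hyo
      obtain ⟨a, hga, hya⟩ := exists_gap_right hg.2.2.1 hy hyi
      have hai := hga.1
      rcases Nat.mod_two_eq_zero_or_one (j + a) with h0 | h0
      · have := hmin a y hga.2.2.1 hy (by omega) (by omega)
        omega
      · have := ho.2.2 j a hga h0
        have : j + o ≠ a := fun h => hna ⟨a, Or.inr ⟨hga, h⟩⟩
        omega
    have := hf.le_of_odd_closed_walk (e := (j - i) / 2) (w := o + 2) (by omega)
      (fun a c ha hc h hodd => by have := hmin a c ha hc h hodd; omega)
      (fun y hy => by
        have := hout y hy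
        have := hleft y hy
        have := hright y hy
        omega) hw hm
    omega
  · refine ⟨i + (j - i) / 2, by omega, fun m hm hw => ?_⟩
    have := hf.le_of_odd_closed_walk (e := (j - i) / 2) (w := o) (by omega)
      (fun a c ha hc h hodd => by have := hmin a c ha hc h hodd; omega)
      (fun y hy => by
        have := hout y hy
        have := hmin y i hy hg.2.1
        have := hmin j y hg.2.2.1 hy
        omega) hw hm
    omega

end Walks

/-! ### Matrices -/

/-- All gaps of `p` have length at most `k + 1`, and one of them has this length. -/
def MaxGap (p : ℕ → Prop) (k : ℕ) : Prop :=
  (∃ i, IsGap p i (i + k + 1)) ∧ ∀ i j, IsGap p i j → j ≤ i + k + 1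

/-- The neighbours of the hub in the graph of `F (companion a)`. -/
def hubSet {n : ℕ} (a : Fin n → Fin 2) (y : ℕ) : Prop :=
  y + 2 = n ∨ (y + 2 ≤ n ∧ ∃ h : y < n, a ⟨y, h⟩ = 1)

section Matrices

variable {n : ℕ} {a : Fin n → Fin 2}

theorem fin_two_cast_pos (x : Fin 2) : (0 : ℝ) < ((x : ℕ) : ℝ) ↔ x = 1 := by
  fin_cases x <;> simp

theorem isFan_hubSet (hn : 3 ≤ n) (h0 : a ⟨0, by omega⟩ = 1) : IsFan n (hubSet a) where
  three_le := hn
  zero := Or.inr ⟨by omega, by omega, h0⟩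
  last := Or.inl (by omega)
  le y h := by rcases h with h | h <;> omega

theorem companion_nonneg (x y : Fin n) : 0 ≤ companion a x y := by
  simp only [companion, Matrix.of_apply]
  split_ifs <;> positivity

theorem companion_pos_iff (x y : Fin n) :
    0 < companion a x y ↔ if (x : ℕ) + 1 = n then a y = 1 else (y : ℕ) = x + 1 := by
  simp only [companion, Matrix.of_apply]
  split_ifs with h1 h2
  · exact fin_two_cast_pos (a y)
  · simp [h2]
  · simp [h2]

theorem F_companion_nonneg (x y : Fin n) : 0 ≤ F (companion a) x y :=
  add_nonneg (companion_nonneg x y) (companion_nonneg y x)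

theorem F_companion_pos_iff (hn : 3 ≤ n) (hlast : a ⟨n - 1, by omega⟩ = 0) (x y : Fin n) :
    0 < F (companion a) x y ↔ Step n (hubSet a) x y := by
  have key : 0 < F (companion a) x y ↔ 0 < companion a x y ∨ 0 < companion a y x := by
    have h1 := companion_nonneg (a := a) x y
    have h2 := companion_nonneg (a := a) y x
    simp only [F, Matrix.add_apply, Matrix.transpose_apply]
    constructor
    · intro h
      by_contra hc
      push Not at hc
      linarith
    · rintro (h | h) <;> linarith
  have hne : ∀ z : Fin n, a z = 1 → (z : ℕ) + 1 ≠ n := by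
    intro z hz h
    have : z = ⟨n - 1, by omega⟩ := Fin.ext (by simp; omega)
    rw [this, hlast] at hz
    exact absurd hz (by decide)
  have hs : ∀ x y : Fin n, 0 < companion a x y →
      (x : ℕ) + 1 = y ∨ ((x : ℕ) + 1 = n ∧ hubSet a y) := by
    intro x y h
    rw [companion_pos_iff] at h
    split_ifs at h with h1
    · have := hne y h
      exact Or.inr ⟨h1, Or.inr ⟨by omega, y.2, h⟩⟩
    · exact Or.inl h.symm
  have hb : ∀ x y : Fin n, (x : ℕ) + 1 = y → 0 < companion a x y := by
    intro x y h
    rw [companion_pos_iff, if_neg (by omega)]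
    exact h.symm
  have hc : ∀ x y : Fin n, (x : ℕ) + 1 = n → hubSet a y →
      0 < companion a x y ∨ 0 < companion a y x := by
    rintro x y h (h' | ⟨-, h1, h2⟩)
    · exact Or.inr (hb y x (by omega))
    · left
      rw [companion_pos_iff, if_pos h]
      exact h2
  rw [key]
  constructor
  · rintro (h | h)
    · rcases hs x y h with h | h
      · exact Or.inl h
      · exact Or.inr (Or.inr (Or.inl h))
    · rcases hs y x h with h | h
      · exact Or.inr (Or.inl h)
      · exact Or.inr (Or.inr (Or.inr h))
  · rintro (h | h | h | h)
    · exact Or.inl (hb x y h)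
    · exact Or.inr (hb y x h)
    · exact hc x y h.1 h.2
    · exact (hc y x h.1 h.2).symm

theorem pow_pos_iff_walk {p : ℕ → Prop} {B : Matrix (Fin n) (Fin n) ℝ} (h0 : ∀ x y, 0 ≤ B x y)
    (h : ∀ x y : Fin n, 0 < B x y ↔ Step n p x y) (m : ℕ) (x y : Fin n) :
    0 < (B ^ m) x y ↔ Walk n p m x y := by
  have hnn : ∀ (m : ℕ) (x y : Fin n), 0 ≤ (B ^ m) x y := by
    intro m
    induction m with
    | zero =>
      intro x y
      rw [pow_zero, Matrix.one_apply]
      split_ifs <;> norm_num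
    | succ m ih =>
      intro x y
      rw [pow_succ, Matrix.mul_apply]
      exact Finset.sum_nonneg fun z _ => mul_nonneg (ih x z) (h0 z y)
  induction m generalizing y with
  | zero =>
    rw [pow_zero, Matrix.one_apply]
    constructor
    · intro hp
      split_ifs at hp with hxy
      · subst hxy
        exact Walk.nil _ x.2
      · exact absurd hp (lt_irrefl _)
    · intro hw
      generalize hx : (x : ℕ) = x' at hw
      generalize hy : (y : ℕ) = y' at hw
      cases hw
      rw [if_pos (Fin.ext (by omega))]
      norm_num
  | succ m ih =>
    rw [pow_succ, Matrix.mul_apply,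
      Finset.sum_pos_iff_of_nonneg fun z _ => mul_nonneg (hnn m x z) (h0 z y)]
    constructor
    · rintro ⟨z, -, hz⟩
      have h1 : 0 < (B ^ m) x z := lt_of_le_of_ne (hnn m x z) fun h => by simp [← h] at hz
      have h2 : 0 < B z y := lt_of_le_of_ne (h0 z y) fun h => by simp [← h] at hz
      exact Walk.snoc ((ih z).1 h1) y.2 ((h z y).1 h2)
    · intro hw
      generalize hy : (y : ℕ) = y' at hw
      cases hw with
      | @snoc _ _ z _ hw hz hs =>
        subst hy
        exact ⟨⟨z, hw.lt_right⟩, Finset.mem_univ _,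
          mul_pos ((ih ⟨z, hw.lt_right⟩).2 hw) ((h ⟨z, hw.lt_right⟩ y).2 hs)⟩

theorem primitive_and_exponent {p : ℕ → Prop} {B : Matrix (Fin n) (Fin n) ℝ}
    (h0 : ∀ x y, 0 ≤ B x y) (h : ∀ x y : Fin n, 0 < B x y ↔ Step n p x y) (hf : IsFan n p)
    {b : ℕ} (hb : HasExp p b) : B.IsPrimitive ∧ exponent B = b := by
  have heven := hb.even
  obtain ⟨o, ho, hU, hL⟩ := hb
  have hb0 : 0 < b := by
    obtain ⟨i, j, ⟨hij, -⟩, h⟩ := hL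
    omega
  have hmem : b ∈ {k : ℕ | 0 < k ∧ ∀ i j, 0 < (B ^ k) i j} :=
    ⟨hb0, fun x y => (pow_pos_iff_walk h0 h b x y).2
      (hf.walk_of_upperCond ho hU heven x.2 y.2)⟩
  refine ⟨⟨h0, b, hmem⟩, IsLeast.csInf_eq ⟨hmem, ?_⟩⟩
  rintro m ⟨hm0, hm⟩
  obtain ⟨x, hx, hlow⟩ := hf.lower_bound ho hL
  have hw : ∀ y, y < n → Walk n p m x y := fun y hy =>
    (pow_pos_iff_walk h0 h m ⟨x, hx⟩ ⟨y, hy⟩).1 (hm _ _)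
  rcases Nat.mod_two_eq_zero_or_one m with hm2 | hm2
  · have hn := hf.three_le
    -- For even m, walk to a neighbour of x and step back: an odd closed walk.
    have hstep : Walk n p (m + 1) x x := by
      by_cases hx1 : x + 1 < n
      · exact Walk.snoc (hw (x + 1) hx1) hx (Or.inr (Or.inl rfl))
      · exact Walk.snoc (hw (x - 1) (by omega)) hx (Or.inl (by omega))
    have := hlow _ (by omega) hstep
    omega
  · have := hlow m hm2 (hw x hx)
    omega

theorem exists_hasExp_of_isPrimitive {p : ℕ → Prop} {B : Matrix (Fin n) (Fin n) ℝ}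
    (h : ∀ x y : Fin n, 0 < B x y ↔ Step n p x y) (hf : IsFan n p) (hB : B.IsPrimitive) :
    ∃ b, HasExp p b := by
  obtain ⟨h0, m, hm0, hm⟩ := hB
  have hn := hf.three_le
  have hw : ∀ y, y < n → Walk n p m 0 y := fun y hy =>
    (pow_pos_iff_walk h0 h m ⟨0, by omega⟩ ⟨y, hy⟩).1 (hm _ _)
  have : ∃ i j, IsGap p i j ∧ (i + j) % 2 = 1 := by
    rcases Nat.mod_two_eq_zero_or_one m with hm2 | hm2
    · exact hf.exists_odd_gap_of_walk (m := m + 1) (by omega)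
        (Walk.snoc (hw 1 (by omega)) (by omega) (Or.inr (Or.inl rfl)))
    · exact hf.exists_odd_gap_of_walk hm2 (hw 0 (by omega))
  obtain ⟨i, j, hg, ho⟩ := this
  exact exists_hasExp hf hg ho

/-- The string covers the vertices 1, …, n - 3, and 0 and n - 2 always lie in `p`; hence maximal
zero runs are the interiors of gaps. -/
theorem isGreatest_zeroRun_iff {p : ℕ → Prop} {Y : Fin (n - 3) → Fin 2} (hf : IsFan n p)
    (hY : ∀ i : Fin (n - 3), p (i + 1) ↔ Y i = 1) (k : ℕ) :
    IsGreatest {l : ℕ | HasZeroRun Y l} k ↔ MaxGap p k := by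
  have hn := hf.three_le
  have hrun : ∀ l, HasZeroRun Y l ↔ ∃ s, s + l + 3 ≤ n ∧ ∀ z, s < z → z ≤ s + l → ¬ p z := by
    intro l
    constructor
    · rintro ⟨s, hs, h⟩
      refine ⟨s, by omega, fun z h1 h2 hz => ?_⟩
      have := h ⟨z - 1, by omega⟩ (by simp; omega) (by simp; omega)
      have h3 := (hY ⟨z - 1, by omega⟩).1 (by rwa [show z - 1 + 1 = z by omega])
      rw [this] at h3
      exact absurd h3 (by decide)
    · rintro ⟨s, hs, h⟩
      refine ⟨s, by omega, fun i h1 h2 => ?_⟩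
      have := h (i + 1) (by omega) (by omega)
      rw [hY] at this
      omega
  have hgaprun : ∀ i j, IsGap p i j → HasZeroRun Y (j - i - 1) := by
    intro i j hg
    have := hf.le j hg.2.2.1
    have := hg.1
    exact (hrun _).2 ⟨i, by omega, fun z h1 h2 => hg.2.2.2 z h1 (by omega)⟩
  constructor
  · rintro ⟨h1, h2⟩
    obtain ⟨s, hs, h⟩ := (hrun k).1 h1
    have hmax : ¬ HasZeroRun Y (k + 1) := fun h => by
      have := h2 h
      omega
    refine ⟨⟨s, by omega, ?_, ?_, fun z a b => h z a (by omega)⟩, fun i j hg => ?_⟩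
    · by_contra hps
      have hs0 : s ≠ 0 := fun h => hps (h ▸ hf.zero)
      refine hmax ((hrun _).2 ⟨s - 1, by omega, fun z a b => ?_⟩)
      rcases Nat.lt_or_ge s z with hz | hz
      · exact h z hz (by omega)
      · rwa [show z = s by omega]
    · by_contra hps
      have hs0 : s + k + 1 ≠ n - 2 := fun h => hps (h ▸ hf.last)
      refine hmax ((hrun _).2 ⟨s, by omega, fun z a b => ?_⟩)
      rcases Nat.lt_or_ge (s + k) z with hz | hz
      · rwa [show z = s + k + 1 by omega]
      · exact h z a hz
    · have := h2 (hgaprun i j hg)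
      omega
  · rintro ⟨⟨i, hg⟩, h2⟩
    refine ⟨?_, fun l hl => ?_⟩
    · have := hgaprun _ _ hg
      rwa [show i + k + 1 - i - 1 = k by omega] at this
    · obtain ⟨s, hs, h⟩ := (hrun l).1 hl
      obtain ⟨i, j, hg, h3, h4, h5, h6⟩ :=
        exists_gap_of_between hf.zero hf.last (Nat.zero_le s) (by omega)
      have h7 := h2 i j hg
      have h8 : ¬ j ≤ s + l := fun h9 => h j h5 h9 hg.2.2.1
      omega

theorem hasString_iff (hn : 4 ≤ n) (Y : Fin (n - 3) → Fin 2) :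
    HasString (F (companion a)) Y ↔ ∀ i : Fin (n - 3), a ⟨i + 1, by omega⟩ = Y i := by
  refine forall_congr' fun i => ?_
  have hi := i.2
  simp only [F, companion, Matrix.add_apply, Matrix.transpose_apply, Matrix.of_apply]
  rw [if_pos (by omega), if_neg (by omega), if_neg (by omega), add_zero, Nat.cast_inj,
    Fin.val_inj]

theorem mem_SC_one_zero_iff (hn : 4 ≤ n) {B : Matrix (Fin n) (Fin n) ℝ} :
    B ∈ SC n 1 0 ↔ ∃ a : Fin n → Fin 2,
      a ⟨0, by omega⟩ = 1 ∧ a ⟨n - 1, by omega⟩ = 0 ∧ B = F (companion a) := by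
  have hrow : ∀ (a : Fin n → Fin 2) (y : Fin n) (e : Fin 2),
      companion a ⟨n - 1, by omega⟩ y = ((e : ℕ) : ℝ) ↔ a y = e := by
    intro a y e
    simp only [companion, Matrix.of_apply]
    rw [if_pos (by omega), Nat.cast_inj, Fin.val_inj]
  constructor
  · rintro ⟨A, ⟨a, rfl⟩, h, h1, h2, rfl⟩
    exact ⟨a, (hrow _ _ _).1 h1, (hrow _ _ _).1 h2, rfl⟩
  · rintro ⟨a, h1, h2, rfl⟩
    exact ⟨_, ⟨a, rfl⟩, by omega, (hrow _ _ _).2 h1, (hrow _ _ _).2 h2, rfl⟩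

theorem hubSet_succ_iff (hn : 4 ≤ n) {Y : Fin (n - 3) → Fin 2}
    (hY : ∀ i : Fin (n - 3), a ⟨i + 1, by omega⟩ = Y i) (i : Fin (n - 3)) :
    hubSet a (i + 1) ↔ Y i = 1 := by
  have hi := i.2
  rw [← hY]
  constructor
  · rintro (h | ⟨h, h1, h2⟩)
    · omega
    · exact h2
  · exact fun h => Or.inr ⟨by omega, by omega, h⟩

/-- A matrix of `PSC n 1 0` in terms of the neighbourhood of the hub of its graph. -/
theorem exists_of_mem_PSC (hn : 4 ≤ n) {B : Matrix (Fin n) (Fin n) ℝ} (hB : B ∈ PSC n 1 0) :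
    ∃ (a : Fin n → Fin 2) (p : ℕ → Prop) (Y : Fin (n - 3) → Fin 2),
      a ⟨0, by omega⟩ = 1 ∧ a ⟨n - 1, by omega⟩ = 0 ∧ B = F (companion a) ∧
      IsFan n p ∧ HasExp p (exponent B) ∧ (∀ i : Fin (n - 3), a ⟨i + 1, by omega⟩ = Y i) ∧
      HasString B Y ∧ ∀ i : Fin (n - 3), p (i + 1) ↔ Y i = 1 := by
  obtain ⟨hS, hp⟩ := hB
  obtain ⟨a, h0, h1, rfl⟩ := (mem_SC_one_zero_iff hn).1 hS
  have hf : IsFan n (hubSet a) := isFan_hubSet (by omega) h0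
  have hpos := F_companion_pos_iff (by omega) h1
  obtain ⟨b, hb⟩ := exists_hasExp_of_isPrimitive hpos hf hp
  have := (primitive_and_exponent F_companion_nonneg hpos hf hb).2
  exact ⟨a, hubSet a, fun i => a ⟨i + 1, by omega⟩, h0, h1, rfl, hf, this ▸ hb, fun _ => rfl,
    (hasString_iff hn _).2 fun _ => rfl, hubSet_succ_iff hn fun _ => rfl⟩

theorem mem_S_iff (hn : 4 ≤ n) {k b : ℕ} :
    k ∈ S n b ↔ ∃ p, IsFan n p ∧ MaxGap p k ∧ HasExp p b := by
  classical
  constructor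
  · rintro ⟨B, ⟨hB, Y', hY', q, hq⟩, hp, rfl⟩
    obtain ⟨a, p, Y, -, -, rfl, hf, hexp, haY, hY, hpY⟩ := exists_of_mem_PSC hn hB
    obtain rfl : Y' = Y := by
      rw [hasString_iff hn] at hY hY'
      funext i
      rw [← hY, ← hY']
    exact ⟨p, hf, (isGreatest_zeroRun_iff hf hpY k).1 hq.2, hexp⟩
  · rintro ⟨p, hf, hk, hb⟩
    set a : Fin n → Fin 2 := fun y => if p y then 1 else 0 with ha
    have h0 : a ⟨0, by omega⟩ = 1 := if_pos hf.zero
    have h1 : a ⟨n - 1, by omega⟩ = 0 := if_neg fun h => by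
      have := hf.le _ h
      simp at this
      omega
    have hpa : hubSet a = p := by
      funext y
      apply propext
      constructor
      · rintro (h | ⟨-, h, h'⟩)
        · have := hf.last
          rwa [show n - 2 = y by omega] at this
        · by_contra hc
          simp [ha, hc] at h'
      · intro h
        have := hf.le y h
        exact Or.inr ⟨this, by omega, if_pos h⟩
    have hpos := F_companion_pos_iff (by omega) h1
    rw [hpa] at hpos
    obtain ⟨hprim, hexp⟩ := primitive_and_exponent F_companion_nonneg hpos hf hb
    refine ⟨F (companion a), ⟨⟨(mem_SC_one_zero_iff hn).2 ⟨a, h0, h1, rfl⟩, hprim⟩,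
      fun i => a ⟨i + 1, by omega⟩, (hasString_iff hn _).2 fun _ => rfl, _, rfl, ?_⟩, hprim, hexp⟩
    refine (isGreatest_zeroRun_iff hf (fun i => ?_) k).2 hk
    rw [← hpa]
    exact hubSet_succ_iff hn (fun _ => rfl) i

theorem exists_maxGap {p : ℕ → Prop} (hf : IsFan n p) : ∃ k, MaxGap p k := by
  classical
  have hn := hf.three_le
  have hex : ∃ k, ∀ i j, IsGap p i j → j ≤ i + k + 1 :=
    ⟨n, fun i j h => by have := hf.le j h.2.2.1; omega⟩
  have hs := Nat.find_spec hex
  refine ⟨Nat.find hex, ?_, hs⟩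
  by_contra hc
  push Not at hc
  obtain ⟨l, hg, -⟩ := exists_gap_right hf.zero hf.last (by omega)
  have h0 : Nat.find hex ≠ 0 := fun h => by
    have h1 := hs 0 l hg
    have h2 := hg.1
    exact hc 0 (by rwa [show 0 + Nat.find hex + 1 = l by omega])
  refine Nat.find_min hex (m := Nat.find hex - 1) (by omega) fun i j hg => ?_
  have h1 := hs i j hg
  have h2 : j ≠ i + Nat.find hex + 1 := fun h => hc i (h ▸ hg)
  omega

theorem exists_mem_S (hn : 4 ≤ n) {B : Matrix (Fin n) (Fin n) ℝ} (hB : B ∈ PSC n 1 0) :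
    ∃ k, k ∈ S n (exponent B) := by
  obtain ⟨a, p, Y, -, -, -, hf, hexp, -⟩ := exists_of_mem_PSC hn hB
  obtain ⟨k, hk⟩ := exists_maxGap hf
  exact ⟨k, (mem_S_iff hn).2 ⟨p, hf, hk, hexp⟩⟩

theorem le_of_mem_binStr {m q k : ℕ} {Y : Fin m → Fin 2} (h : Y ∈ BinStr m q k) :
    k ≤ q ∧ q ≤ m := by
  obtain ⟨rfl, ⟨s, hs, h⟩, -⟩ := h
  constructor
  · have hinj : Set.InjOn (fun i : Fin m => (i : ℕ)) {i : Fin m | Y i = 0} :=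
      fun _ _ _ _ h => Fin.ext h
    rw [← hinj.ncard_image]
    have : (Set.Ico s (s + k)).ncard = k := by
      rw [Set.ncard_eq_toFinset_card', Set.toFinset_Ico, Nat.card_Ico]
      omega
    rw [← this]
    refine Set.ncard_le_ncard ?_ (Set.toFinite _)
    rintro z ⟨h1, h2⟩
    exact ⟨⟨z, by omega⟩, h ⟨z, by omega⟩ h1 h2, rfl⟩
  · refine (Set.ncard_le_ncard (Set.subset_univ _)).trans ?_
    rw [Set.ncard_univ, Nat.card_eq_fintype_card, Fintype.card_fin]

/-- The string determines the last row except in column n - 2, which does not affect the graph; this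
free bit gives the factor 2. -/
theorem N_le (hn : 4 ≤ n) {b : ℕ} (T : Finset ℕ) (hT : ∀ k ∈ S n b, k ∈ T) :
    N n b ≤ 2 * ∑ k ∈ T, ∑ q ∈ Finset.Icc k (n - 3), (BinStr (n - 3) q k).ncard := by
  classical
  set U : Set (Fin (n - 3) → Fin 2) :=
    ⋃ k ∈ T, ⋃ q ∈ Finset.Icc k (n - 3), BinStr (n - 3) q k with hU
  have hUcard : U.ncard ≤ ∑ k ∈ T, ∑ q ∈ Finset.Icc k (n - 3), (BinStr (n - 3) q k).ncard :=
    (Finset.set_ncard_biUnion_le _ _).trans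
      (Finset.sum_le_sum fun k _ => Finset.set_ncard_biUnion_le _ _)
  set row : Fin 2 → (Fin (n - 3) → Fin 2) → Fin n → Fin 2 := fun e Y y =>
    if (y : ℕ) = 0 then 1 else if h : (y : ℕ) - 1 < n - 3 then Y ⟨y - 1, h⟩
      else if (y : ℕ) + 1 = n then 0 else e with hrow
  have hsub : {A | A ∈ PSC n 1 0 ∧ exponent A = b} ⊆
      (fun Y => F (companion (row 0 Y))) '' U ∪ (fun Y => F (companion (row 1 Y))) '' U := by
    rintro B ⟨hB, rfl⟩
    obtain ⟨a, p, Y, h0, h1, rfl, hf, hexp, haY, hY, hpY⟩ := exists_of_mem_PSC hn hB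
    obtain ⟨k, hk⟩ := exists_maxGap hf
    have hkT := hT k ((mem_S_iff hn).2 ⟨p, hf, hk, hexp⟩)
    have hYq : Y ∈ BinStr (n - 3) _ k := ⟨rfl, (isGreatest_zeroRun_iff hf hpY k).2 hk⟩
    have hYU : Y ∈ U := by
      simp only [hU, Set.mem_iUnion]
      exact ⟨k, hkT, _, Finset.mem_Icc.2 (le_of_mem_binStr hYq), hYq⟩
    have ha : a = row (a ⟨n - 2, by omega⟩) Y := by
      funext y
      simp only [hrow]
      split_ifs with c1 c2 c3
      · rw [← h0]; congr 1; exact Fin.ext c1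
      · rw [← haY]; congr 1; exact Fin.ext (by simp; omega)
      · rw [← h1]; congr 1; exact Fin.ext (by simp; omega)
      · congr 1; exact Fin.ext (by simp; omega)
    have he : a ⟨n - 2, by omega⟩ = 0 ∨ a ⟨n - 2, by omega⟩ = 1 := by omega
    rcases he with he | he
    · exact Or.inl ⟨Y, hYU, by simp only; rw [← he, ← ha]⟩
    · exact Or.inr ⟨Y, hYU, by simp only; rw [← he, ← ha]⟩
  have h1 := Set.ncard_le_ncard hsub ((Set.toFinite _).union (Set.toFinite _))
  have h2 := Set.ncard_union_le ((fun Y => F (companion (row 0 Y))) '' U)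
    ((fun Y => F (companion (row 1 Y))) '' U)
  have h3 := Set.ncard_image_le (f := fun Y => F (companion (row 0 Y))) (Set.toFinite U)
  have h4 := Set.ncard_image_le (f := fun Y => F (companion (row 1 Y))) (Set.toFinite U)
  unfold N
  omega

end Matrices

/-! ### Necessary conditions -/

section Necessary

variable {n k b : ℕ} {p : ℕ → Prop}

theorem HasExp.bounds (hk : MaxGap p k) (hb : HasExp p b) : k + 2 ≤ b ∧ b ≤ 2 * k + 4 := by
  obtain ⟨o, ⟨ho, ⟨a, hgo⟩, homin⟩, hU, i, j, hg, hL⟩ := hb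
  obtain ⟨⟨c, hc⟩, hmax⟩ := hk
  have h1 := hmax _ _ hg
  have h2 := hmax _ _ hgo
  have hlt := hg.1
  constructor
  · rcases Nat.mod_two_eq_zero_or_one (c + (c + k + 1)) with h | h
    · have := hU.2 _ _ hc h
      omega
    · have := hU.1 _ _ hc h
      omega
  · omega

theorem HasExp.eq_two_of_maxGap_zero (hk : MaxGap p 0) (hb : HasExp p b) : b = 2 := by
  obtain ⟨o, -, -, i, j, hg, hL⟩ := hb
  have h1 := hk.2 _ _ hg
  have hlt := hg.1
  omega

/-- Two gaps that do not touch are at least 2 apart: at distance 1 the segment between them would be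
an odd gap of length 1, forcing o = 1 and adjacency. -/
theorem IsFan.even_add_odd_le {o i j a c : ℕ} (hf : IsFan n p) (ho : IsMinOdd p o)
    (hg : IsGap p i j) (hna : ¬ Adjacent p o i j) (hg' : IsGap p a c) (hac : c = a + o)
    (hp : (i + j) % 2 = 0) : j + c + 4 ≤ n + i + a := by
  have h1 := hf.le _ hg.2.2.1
  have h2 := hf.le _ hg'.2.2.1
  have hlt := hg.1
  have hlt' := hg'.1
  have ho1 := ho.1
  have n1 : c ≠ i := fun h => hna ⟨a, Or.inl ⟨h ▸ hg', by omega⟩⟩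
  have n2 : a ≠ j := fun h => hna ⟨c, Or.inr ⟨h ▸ hg', by omega⟩⟩
  have e1 : ¬ (c + 1 = i) := fun h => by
    have := ho.le_of_odd hg'.2.2.1 hg.2.1 (by omega) (by omega)
    refine hna ⟨c, Or.inl ⟨⟨by omega, hg'.2.2.1, hg.2.1, fun z _ _ => by omega⟩, by omega⟩⟩
  have e2 : ¬ (j + 1 = a) := fun h => by
    have := ho.le_of_odd hg.2.2.1 hg'.2.1 (by omega) (by omega)
    refine hna ⟨a, Or.inr ⟨⟨by omega, hg.2.2.1, hg'.2.1, fun z _ _ => by omega⟩, by omega⟩⟩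
  have := hg.disjoint hg'
  omega

theorem HasExp.lt_order (hf : IsFan n p) (hb : HasExp p b) : b + 1 ≤ n := by
  obtain ⟨o, ho, hU, i, j, hg, hL⟩ := hb
  have ho1 := ho.1
  obtain ⟨a, hgo⟩ := ho.2.1
  have h1 := hf.le _ hg.2.2.1
  have h2 := hf.le _ hgo.2.2.1
  have hlt := hg.1
  rcases hL with h | ⟨hp, ⟨h, hna⟩ | h⟩
  · omega
  · have := hf.even_add_odd_le ho hg hna hgo rfl hp
    omega
  · have := hg.disjoint hgo
    omega

/-- Since n - 2 is even, the number of odd gaps is even. -/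
theorem IsFan.exists_other_odd_gap {i j : ℕ} (hf : IsFan n p) (hn : n % 2 = 0)
    (hg : IsGap p i j) (hp : (i + j) % 2 = 1) :
    ∃ i' j', IsGap p i' j' ∧ (i' + j') % 2 = 1 ∧ (j' ≤ i ∨ j ≤ i') := by
  have h1 := hf.le _ hg.2.2.1
  have hn3 := hf.three_le
  rcases Nat.mod_two_eq_zero_or_one i with hi | hi
  · obtain ⟨i', j', h, h', h2, h3⟩ := exists_odd_gap hg.2.2.1 hf.last (by omega) (by omega)
    exact ⟨i', j', h, h', Or.inr h2⟩
  · obtain ⟨i', j', h, h', h2, h3⟩ := exists_odd_gap hf.zero hg.2.1 (by omega) (by omega)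
    exact ⟨i', j', h, h', Or.inl h3⟩

/-- With b = k + 4 the longest gap is odd and n ≤ 2k + 3. Lack of room forces o = k + 1, and every
other gap has length 2 and touches the longest one. So there are at most two others, and n ≤ b + 3.
-/
theorem HasExp.ne_add_four (hf : IsFan n p) (hk : MaxGap p k) (hb : HasExp p b)
    (h1 : b + 5 ≤ n) (h2 : n ≤ 2 * b - 5) : b ≠ k + 4 := by
  rintro rfl
  have hbe := hb.even
  obtain ⟨o, ho, hU, i, j, hg, hL⟩ := hb
  have ho1 := ho.1
  obtain ⟨a, hgo⟩ := ho.2.1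
  obtain ⟨⟨c, hc⟩, hmax⟩ := hk
  have l1 := hf.le _ hg.2.2.1
  have l2 := hf.le _ hgo.2.2.1
  have l3 := hf.le _ hc.2.2.1
  have m1 := hmax _ _ hg
  have hlt := hg.1
  have d1 := hg.disjoint hc
  have d2 := hg.disjoint hgo
  have d3 := hc.disjoint hgo
  have hoc := ho.2.2 _ _ hc (by omega)
  rcases hL with h | ⟨hp, ⟨h, hna⟩ | h⟩
  · omega
  · omega
  · -- the even gaps have length two and touch the gap of length `o`
    obtain rfl : o = k + 1 := by omega
    have hodd : ∀ u v, IsGap p u v → (u + v) % 2 = 1 → u = c := by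
      intro u v hgu hpu
      have := ho.2.2 u v hgu hpu
      have := hf.le _ hgu.2.2.1
      have e1 := hgu.disjoint hc
      have e2 := hgu.disjoint hg
      omega
    have heven : ∀ u v, IsGap p u v → u ≠ c → v = u + 2 ∧ (v = c ∨ u = c + k + 1) := by
      intro u v hgu hne
      have hpu : (u + v) % 2 = 0 := by
        by_contra hc
        exact hne (hodd u v hgu (by omega))
      have hlt := hgu.1
      rcases hU.2 u v hgu hpu with h | ⟨h, w, ⟨hw, hw'⟩ | ⟨hw, hw'⟩⟩
      · omega
      · have := hodd w u hw (by omega)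
        omega
      · have := hodd v w hw (by omega)
        omega
    rcases Nat.lt_or_ge 2 c with hc3 | hc3
    · obtain ⟨u, hu, -⟩ := exists_gap_left hf.zero hc.2.1 (by omega)
      have e1 := heven u c hu (by have := hu.1; omega)
      obtain ⟨v, hv, -⟩ := exists_gap_left hf.zero hu.2.1 (by omega)
      have := hv.1
      have e2 := heven v u hv (by omega)
      omega
    · obtain ⟨u, hu, -⟩ := exists_gap_right hc.2.2.1 hf.last (by omega)
      have e1 := heven _ u hu (by omega)
      obtain ⟨v, hv, -⟩ := exists_gap_right hu.2.2.1 hf.last (by omega)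
      have e2 := heven u v hv (by omega)
      omega

theorem HasExp.le_ell (hf : IsFan n p) (hk : MaxGap p k) (hb : HasExp p b) (hn : n % 2 = 0)
    (hodd : k % 2 = 1) : b ≤ ell n k := by
  have hbd := hb.bounds hk
  have hbe := hb.even
  obtain ⟨o, ho, hU, i, j, hg, hL⟩ := hb
  have ho1 := ho.1
  obtain ⟨a, hgo⟩ := ho.2.1
  obtain ⟨⟨c, hc⟩, hmax⟩ := hk
  obtain ⟨u, v, hg2, hp2, hd2⟩ := hf.exists_other_odd_gap hn hgo (by omega)
  have l1 := hf.le _ hg.2.2.1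
  have l2 := hf.le _ hgo.2.2.1
  have l3 := hf.le _ hc.2.2.1
  have l4 := hf.le _ hg2.2.2.1
  have m1 := hmax _ _ hg
  have hlt := hg.1
  have hlt2 := hg2.1
  have hmin := ho.2.2 _ _ hg2 hp2
  have d1 := hg.disjoint hgo
  have d2 := hg.disjoint hg2
  have d3 := hc.disjoint hgo
  have d4 := hc.disjoint hg2
  have hsum : k + 1 + 2 * o + 2 ≤ n := by omega
  have key : b ≤ k + o + 2 ∨ (b ≤ k + o + 4 ∧ k + 1 + 2 * o + 4 ≤ n) := by
    rcases hL with h | ⟨hp, ⟨h, hna⟩ | h⟩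
    · omega
    · by_cases hlt : j < i + k + 1
      · omega
      right
      have hsum' : (j - i) + 2 * o + 2 ≤ n := by omega
      refine ⟨by omega, ?_⟩
      -- Without two units of slack, the longest gap and two gaps of length o fill the path, so one
      -- of the latter touches the former.
      by_contra hcon
      have hv : v = u + o := by omega
      have n1 : a + o ≠ i := fun h => hna ⟨a, Or.inl ⟨h ▸ hgo, h⟩⟩
      have n2 : a ≠ j := fun h => hna ⟨a + o, Or.inr ⟨h ▸ hgo, by omega⟩⟩
      have n3 : v ≠ i := fun h => hna ⟨u, Or.inl ⟨h ▸ hg2, by omega⟩⟩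
      have n4 : u ≠ j := fun h => hna ⟨v, Or.inr ⟨h ▸ hg2, by omega⟩⟩
      omega
    · omega
  unfold ell
  split_ifs <;> omega

theorem HasExp.of_odd_maxGap (hf : IsFan n p) (hk : MaxGap p k) (hb : HasExp p b)
    (hn : n % 2 = 0) (heven : k % 2 = 0) (h3 : n ≤ 3 * k + 5) (hne : b ≠ k + 2) :
    k + b ≤ n ∧ b ≤ 2 * k + 2 := by
  have hbd := hb.bounds hk
  have hbe := hb.even
  obtain ⟨o, ho, hU, i, j, hg, hL⟩ := hb
  have ho1 := ho.1
  obtain ⟨⟨c, hc⟩, hmax⟩ := hk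
  have m1 := hmax _ _ hg
  have hlt := hg.1
  have hoc := ho.2.2 _ _ hc (by omega)
  have l1 := hf.le _ hg.2.2.1
  have l3 := hf.le _ hc.2.2.1
  have hEven : (i + j) % 2 = 0 := by
    rcases hL with h | h
    · omega
    · exact h.1
  have d1 := hg.disjoint hc
  -- If o is the maximal length, the second odd gap has it too; otherwise the tight even gap, the
  -- longest gap and a gap of length o are distinct. Either way three gaps compete for n - 2.
  by_cases hok : o = k + 1
  · subst hok
    obtain ⟨u, v, hg2, hp2, hd2⟩ := hf.exists_other_odd_gap hn hc (by omega)
    have l4 := hf.le _ hg2.2.2.1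
    have hlt2 := hg2.1
    have hmin := ho.2.2 _ _ hg2 hp2
    have hmax2 := hmax _ _ hg2
    have d2 := hg.disjoint hg2
    rcases hL with h | ⟨hp, ⟨h, hna⟩ | h⟩
    · omega
    · have n1 : c + (k + 1) ≠ i := fun h => hna ⟨c, Or.inl ⟨h ▸ hc, h⟩⟩
      have n2 : c ≠ j := fun h => hna ⟨c + k + 1, Or.inr ⟨h ▸ hc, by omega⟩⟩
      have n3 : v ≠ i := fun h => hna ⟨u, Or.inl ⟨h ▸ hg2, by omega⟩⟩
      have n4 : u ≠ j := fun h => hna ⟨v, Or.inr ⟨h ▸ hg2, by omega⟩⟩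
      omega
    · omega
  · obtain ⟨a, hgo⟩ := ho.2.1
    have l2 := hf.le _ hgo.2.2.1
    have d2 := hg.disjoint hgo
    have d3 := hc.disjoint hgo
    omega

end Necessary

/-! ### Constructions -/

/-- The points `0 ≤ a₁ ≤ a₂ ≤ a₃ ≤ a₄` followed by points at distance `f`, up to `n - 2`. -/
def pattern (n f a₁ a₂ a₃ a₄ y : ℕ) : Prop :=
  y + 2 ≤ n ∧ (y = 0 ∨ y = a₁ ∨ y = a₂ ∨ y = a₃ ∨ (a₄ ≤ y ∧ (y - a₄) % f = 0))

/-- The gaps of `pattern`. -/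
def PatternGap (n f a₁ a₂ a₃ a₄ i j : ℕ) : Prop :=
  i < j ∧ ((i = 0 ∧ j = a₁) ∨ (i = a₁ ∧ j = a₂) ∨ (i = a₂ ∧ j = a₃) ∨ (i = a₃ ∧ j = a₄) ∨
    (a₄ ≤ i ∧ (i - a₄) % f = 0 ∧ j = i + f ∧ j + 2 ≤ n))

section Constructions

variable {n k b : ℕ}

theorem isFan_pattern {f a₁ a₂ a₃ a₄ : ℕ} (hn : 3 ≤ n) (hlast : (n - 2 - a₄) % f = 0)
    (h4 : a₄ + 2 ≤ n) : IsFan n (pattern n f a₁ a₂ a₃ a₄) where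
  three_le := hn
  zero := ⟨by omega, Or.inl rfl⟩
  last := ⟨by omega, Or.inr (Or.inr (Or.inr (Or.inr ⟨by omega, hlast⟩)))⟩
  le _ h := h.1

theorem isGap_pattern_iff {f a₁ a₂ a₃ a₄ : ℕ} (hf : f = 1 ∨ f = 2)
    (h2 : a₁ ≤ a₂) (h3 : a₂ ≤ a₃) (h4 : a₃ ≤ a₄) (h5 : a₄ + 2 ≤ n)
    (hlast : (n - 2 - a₄) % f = 0) (i j : ℕ) :
    IsGap (pattern n f a₁ a₂ a₃ a₄) i j ↔ PatternGap n f a₁ a₂ a₃ a₄ i j := by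
  unfold IsGap pattern PatternGap
  constructor
  · rintro ⟨hij, ⟨hi, hi'⟩, ⟨hj, hj'⟩, h⟩
    have z1 : a₁ ≤ i ∨ j ≤ a₁ := by
      by_contra hc
      exact h a₁ (by omega) (by omega) ⟨by omega, Or.inr (Or.inl rfl)⟩
    have z2 : a₂ ≤ i ∨ j ≤ a₂ := by
      by_contra hc
      exact h a₂ (by omega) (by omega) ⟨by omega, Or.inr (Or.inr (Or.inl rfl))⟩
    have z3 : a₃ ≤ i ∨ j ≤ a₃ := by
      by_contra hc
      exact h a₃ (by omega) (by omega) ⟨by omega, Or.inr (Or.inr (Or.inr (Or.inl rfl)))⟩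
    have z4 : a₄ ≤ i ∨ j ≤ a₄ := by
      by_contra hc
      exact h a₄ (by omega) (by omega)
        ⟨by omega, Or.inr (Or.inr (Or.inr (Or.inr ⟨le_rfl, by simp⟩)))⟩
    refine ⟨hij, ?_⟩
    by_cases hai : a₄ ≤ i
    · have hif : (i - a₄) % f = 0 := by
        by_cases he : i = a₄
        · simp [he]
        · rcases hi' with e | e | e | e | e
          · omega
          · omega
          · omega
          · omega
          · exact e.2
      have hjf : (j - a₄) % f = 0 := by
        rcases hj' with e | e | e | e | e
        · omega
        · omega
        · omega
        · omega
        · exact e.2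
      have z5 : j ≤ i + f := by
        by_contra hc
        refine h (i + f) (by omega) (by omega)
          ⟨by omega, Or.inr (Or.inr (Or.inr (Or.inr ⟨by omega, ?_⟩)))⟩
        rw [show i + f - a₄ = i - a₄ + f by omega, Nat.add_mod_right, hif]
      refine Or.inr (Or.inr (Or.inr (Or.inr ⟨hai, hif, ?_, hj⟩)))
      rcases hf with rfl | rfl <;> omega
    · rcases hi' with e | e | e | e | e <;> rcases hj' with e' | e' | e' | e' | e' <;> omega
  · rintro ⟨hij, h⟩
    refine ⟨hij, ⟨by omega, ?_⟩, ⟨by omega, ?_⟩, ?_⟩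
    · rcases h with h | h | h | h | h
      · exact Or.inl h.1
      · exact Or.inr (Or.inl h.1)
      · exact Or.inr (Or.inr (Or.inl h.1))
      · exact Or.inr (Or.inr (Or.inr (Or.inl h.1)))
      · exact Or.inr (Or.inr (Or.inr (Or.inr ⟨h.1, h.2.1⟩)))
    · rcases h with h | h | h | h | ⟨h, h', rfl, -⟩
      · exact Or.inr (Or.inl h.2)
      · exact Or.inr (Or.inr (Or.inl h.2))
      · exact Or.inr (Or.inr (Or.inr (Or.inl h.2)))
      · exact Or.inr (Or.inr (Or.inr (Or.inr ⟨by omega, by simp [h.2]⟩)))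
      · refine Or.inr (Or.inr (Or.inr (Or.inr ⟨by omega, ?_⟩)))
        rw [show i + f - a₄ = i - a₄ + f by omega, Nat.add_mod_right, h']
    · rintro z hz hz' ⟨-, e | e | e | e | e⟩ <;> rcases h with h | h | h | h | h <;>
        first | omega | (rcases hf with rfl | rfl <;> omega)

/-- A certificate checked on listed gaps only. Coinciding points encode shorter lists, attainment is
asked at an even gap, and `o ≤ i` guards the truncated `i - o`. -/
theorem mem_S_of_pattern (hn : 4 ≤ n) {f a₁ a₂ a₃ a₄ : ℕ} (o : ℕ) (hf : f = 1 ∨ f = 2)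
    (h2 : a₁ ≤ a₂) (h3 : a₂ ≤ a₃) (h4 : a₃ ≤ a₄) (h5 : a₄ + 2 ≤ n)
    (hlast : (n - 2 - a₄) % f = 0) (ho : o % 2 = 1)
    (hmem : ∃ i, PatternGap n f a₁ a₂ a₃ a₄ i (i + k + 1))
    (hmin : ∃ i, PatternGap n f a₁ a₂ a₃ a₄ i (i + o))
    (hmax : ∀ i j, PatternGap n f a₁ a₂ a₃ a₄ i j → j ≤ i + k + 1)
    (hodd : ∀ i j, PatternGap n f a₁ a₂ a₃ a₄ i j → (i + j) % 2 = 1 →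
      i + o ≤ j ∧ j + 1 ≤ i + b)
    (heven : ∀ i j, PatternGap n f a₁ a₂ a₃ a₄ i j → (i + j) % 2 = 0 →
      j + o + 3 ≤ i + b ∨ (j + o + 1 ≤ i + b ∧
        ((i ≠ 0 ∧ PatternGap n f a₁ a₂ a₃ a₄ (i - o) i ∧ o ≤ i) ∨
          PatternGap n f a₁ a₂ a₃ a₄ j (j + o))))
    (hlow : ∃ i j, PatternGap n f a₁ a₂ a₃ a₄ i j ∧ (i + j) % 2 = 0 ∧
      ((j + o + 3 = i + b ∧ ¬ PatternGap n f a₁ a₂ a₃ a₄ j (j + o) ∧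
        ∀ a, a + o = i → ¬ PatternGap n f a₁ a₂ a₃ a₄ a i) ∨ j + o + 1 = i + b)) :
    k ∈ S n b := by
  have hiff := isGap_pattern_iff hf h2 h3 h4 h5 hlast
  refine (mem_S_iff hn).2 ⟨pattern n f a₁ a₂ a₃ a₄, isFan_pattern (by omega) hlast h5, ?_, o,
    ⟨ho, ?_, ?_⟩, ⟨?_, ?_⟩, ?_⟩
  · simp only [MaxGap, hiff]
    exact ⟨hmem, hmax⟩
  · simpa only [hiff] using hmin
  · simp only [hiff]
    exact fun i j h h' => (hodd i j h h').1
  · simp only [hiff]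
    exact fun i j h h' => (hodd i j h h').2
  · simp only [hiff, Adjacent]
    intro i j h h'
    rcases heven i j h h' with h | ⟨h, ⟨-, h1, h2⟩ | h1⟩
    · exact Or.inl h
    · exact Or.inr ⟨h, i - o, Or.inl ⟨h1, by omega⟩⟩
    · exact Or.inr ⟨h, j + o, Or.inr ⟨h1, rfl⟩⟩
  · obtain ⟨i, j, h, hp, hc⟩ := hlow
    refine ⟨i, j, (hiff i j).2 h, Or.inr ⟨hp, hc.imp (fun h => ⟨h.1, ?_⟩) id⟩⟩
    simp only [hiff, Adjacent]
    rintro ⟨a, ⟨h1, h2⟩ | ⟨h1, rfl⟩⟩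
    · exact h.2.2 a h2 h1
    · exact h.2.1 h1

/-- Gaps `K, 1, 1, …` with `K` odd. -/
theorem mem_S_of_even (hn : 4 ≤ n) (hk : k % 2 = 0) (h : k + 3 ≤ n) : k ∈ S n (k + 2) := by
  have hiff := isGap_pattern_iff (n := n) (f := 1) (Or.inl rfl) (le_refl (k + 1)) le_rfl le_rfl
    (by omega) (Nat.mod_one _)
  have hf : IsFan n (pattern n 1 (k + 1) (k + 1) (k + 1) (k + 1)) :=
    isFan_pattern (by omega) (Nat.mod_one _) (by omega)
  have hg : IsGap (pattern n 1 (k + 1) (k + 1) (k + 1) (k + 1)) 0 (k + 1) :=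
    (hiff _ _).2 ⟨by omega, Or.inl ⟨rfl, rfl⟩⟩
  obtain ⟨o, ho⟩ := exists_isMinOdd hg (by omega)
  refine (mem_S_iff hn).2 ⟨_, hf, ⟨⟨0, by rwa [Nat.zero_add]⟩, fun i j h => ?_⟩, o, ho,
    ⟨fun i j h h' => ?_, fun i j h h' => ?_⟩, 0, k + 1, hg, Or.inl (by omega)⟩ <;>
  · rw [hiff, PatternGap] at h
    omega

/-- Gaps `2, 1, 1, …`. -/
theorem one_mem_S_four (hn : 5 ≤ n) : 1 ∈ S n 4 := by
  refine mem_S_of_pattern (f := 1) (a₁ := 2) (a₂ := 2) (a₃ := 2) (a₄ := 2) (by omega) 1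
    (Or.inl rfl) le_rfl le_rfl le_rfl (by omega) (Nat.mod_one _) rfl
    ⟨0, by omega, by omega⟩ ⟨2, by omega, by omega⟩ ?_ ?_ ?_
    ⟨0, 2, ⟨by omega, by omega⟩, by omega, Or.inr (by omega)⟩
  · rintro i j ⟨hij, h | h | h | h | h⟩ <;> omega
  · rintro i j ⟨hij, h | h | h | h | h⟩ hp <;> omega
  · rintro i j ⟨hij, ⟨rfl, rfl⟩ | h | h | h | h⟩ hp
    · exact Or.inr ⟨by omega, Or.inr ⟨by omega, by omega⟩⟩
    all_goals omega

/-- Gaps `K, o, c, 2, 2, …` with `K` even and `c ∈ {0, o}`. -/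
theorem mem_S_of_adjacent {K o c : ℕ} (hn : 4 ≤ n) (hK : K % 2 = 0) (hK4 : 4 ≤ K)
    (ho : o % 2 = 1) (hoK : o < K) (hc : c = 0 ∨ c = o) (hle : K + o + c + 2 ≤ n)
    (hpar : (n + K + o + c) % 2 = 0) : K - 1 ∈ S n (K + o + 1) := by
  refine mem_S_of_pattern (f := 2) (a₁ := K) (a₂ := K + o) (a₃ := K + o + c) (a₄ := K + o + c)
    hn o (Or.inr rfl) (by omega) (by omega) (by omega) (by omega) (by omega) ho
    ⟨0, by omega, by omega⟩ ⟨K, by omega, by omega⟩ ?_ ?_ ?_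
    ⟨0, K, ⟨by omega, by omega⟩, by omega, Or.inr (by omega)⟩
  · rintro i j ⟨hij, h | h | h | h | h⟩ <;> omega
  · rintro i j ⟨hij, h | h | h | h | h⟩ hp <;> omega
  · rintro i j ⟨hij, ⟨rfl, rfl⟩ | h | h | h | h⟩ hp
    · exact Or.inr ⟨by omega, Or.inr ⟨by omega, Or.inr (Or.inl ⟨rfl, rfl⟩)⟩⟩
    -- Fillers of length 2 contribute at most o + 5, which is harmless because `4 ≤ K`.
    all_goals left; omega

/-- Gaps `K, 2, o, c, 2, 2, …` with `K` even and `c ∈ {0, o}`. -/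
theorem mem_S_of_separated {K o c : ℕ} (hn : 4 ≤ n) (hK : K % 2 = 0) (hK2 : 2 ≤ K)
    (ho : o % 2 = 1) (hoK : o < K) (hc : c = 0 ∨ c = o) (hle : K + 2 + o + c + 2 ≤ n)
    (hpar : (n + K + o + c) % 2 = 0) : K - 1 ∈ S n (K + o + 3) := by
  refine mem_S_of_pattern (f := 2) (a₁ := K) (a₂ := K + 2) (a₃ := K + 2 + o)
    (a₄ := K + 2 + o + c)
    hn o (Or.inr rfl) (by omega) (by omega) (by omega) (by omega) (by omega) ho
    ⟨0, by omega, by omega⟩ ⟨K + 2, by omega, by omega⟩ ?_ ?_ ?_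
    ⟨0, K, ⟨by omega, by omega⟩, by omega, Or.inl ⟨by omega, ?_, ?_⟩⟩
  · rintro i j ⟨hij, h | h | h | h | h⟩ <;> omega
  · rintro i j ⟨hij, h | h | h | h | h⟩ hp <;> omega
  · rintro i j ⟨hij, h | h | h | h | h⟩ hp <;> left <;> omega
  · rintro ⟨hij, h | h | h | h | h⟩ <;> omega
  · rintro a ha ⟨hij, h | h | h | h | h⟩ <;> omega

/-- Gaps `K, E, 2, 2, …` with `K` odd and `E` even. -/
theorem mem_S_of_odd_adjacent {K E : ℕ} (hn : 4 ≤ n) (hK : K % 2 = 1) (hE : E % 2 = 0)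
    (hE4 : 4 ≤ E) (hEK : E < K) (hle : K + E + 2 ≤ n) (hpar : (n + K) % 2 = 0) :
    K - 1 ∈ S n (E + K + 1) := by
  refine mem_S_of_pattern (f := 2) (a₁ := K) (a₂ := K + E) (a₃ := K + E) (a₄ := K + E)
    hn K (Or.inr rfl) (by omega) (by omega) (by omega) (by omega) (by omega) hK
    ⟨0, by omega, by omega⟩ ⟨0, by omega, by omega⟩ ?_ ?_ ?_
    ⟨K, K + E, ⟨by omega, by omega⟩, by omega, Or.inr (by omega)⟩
  · rintro i j ⟨hij, h | h | h | h | h⟩ <;> omega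
  · rintro i j ⟨hij, h | h | h | h | h⟩ hp <;> omega
  · rintro i j ⟨hij, h | ⟨rfl, rfl⟩ | h | h | h⟩ hp
    · left; omega
    · exact Or.inr ⟨by omega, Or.inl ⟨by omega, ⟨by omega, Or.inl ⟨by omega, rfl⟩⟩, le_rfl⟩⟩
    all_goals left; omega

/-- Gaps `K, c, 2, E, 2, 2, …` with `K` odd, `E` even and `c ∈ {0, K}`. -/
theorem mem_S_of_odd_separated {K E c : ℕ} (hn : 4 ≤ n) (hK : K % 2 = 1) (hE : E % 2 = 0)
    (hE2 : 2 ≤ E) (hEK : E < K) (hc : c = 0 ∨ c = K) (hle : K + c + 2 + E + 2 ≤ n)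
    (hpar : (n + K + c) % 2 = 0) : K - 1 ∈ S n (E + K + 3) := by
  refine mem_S_of_pattern (f := 2) (a₁ := K) (a₂ := K + c) (a₃ := K + c + 2)
    (a₄ := K + c + 2 + E)
    hn K (Or.inr rfl) (by omega) (by omega) (by omega) (by omega) (by omega) hK
    ⟨0, by omega, by omega⟩ ⟨0, by omega, by omega⟩ ?_ ?_ ?_
    ⟨K + c + 2, K + c + 2 + E, ⟨by omega, by omega⟩, by omega, Or.inl ⟨by omega, ?_, ?_⟩⟩
  · rintro i j ⟨hij, h | h | h | h | h⟩ <;> omega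
  · rintro i j ⟨hij, h | h | h | h | h⟩ hp <;> omega
  · rintro i j ⟨hij, h | h | h | h | h⟩ hp <;> left <;> omega
  · rintro ⟨hij, h | h | h | h | h⟩ <;> omega
  · rintro a ha ⟨hij, h | h | h | h | h⟩ <;> omega

/-- Gaps `K - 1, K, o, 2, 2, …` with `K` and `o` odd. -/
theorem mem_S_of_odd_between {K o : ℕ} (hn : 4 ≤ n) (hK : K % 2 = 1) (ho : o % 2 = 1)
    (hK3 : 3 ≤ K) (hoK : o < K) (hle : 2 * K + o + 1 ≤ n) (hpar : n % 2 = 0) :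
    K - 1 ∈ S n (K + o + 2) := by
  refine mem_S_of_pattern (f := 2) (a₁ := K - 1) (a₂ := K - 1 + K) (a₃ := K - 1 + K + o)
    (a₄ := K - 1 + K + o)
    hn o (Or.inr rfl) (by omega) (by omega) (by omega) (by omega) (by omega) ho
    ⟨K - 1, by omega, by omega⟩ ⟨K - 1 + K, by omega, by omega⟩ ?_ ?_ ?_
    -- The tight gap starts at 0 and is followed by one of length K > o, so it touches no gap of
    -- length o.
    ⟨0, K - 1, ⟨by omega, by omega⟩, by omega, Or.inl ⟨by omega, ?_, ?_⟩⟩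
  · rintro i j ⟨hij, h | h | h | h | h⟩ <;> omega
  · rintro i j ⟨hij, h | h | h | h | h⟩ hp <;> omega
  · rintro i j ⟨hij, h | h | h | h | h⟩ hp <;> left <;> omega
  · rintro ⟨hij, h | h | h | h | h⟩ <;> omega
  · rintro a ha ⟨hij, h | h | h | h | h⟩ <;> omega

end Constructions

/-! ### Matching the constructions with the necessary conditions -/

section Main

variable {n k b : ℕ}

theorem mem_S_congr {k' b' : ℕ} (h : k' ∈ S n b') (hk : k' = k) (hb : b' = b) : k ∈ S n b :=
  hk ▸ hb ▸ h

theorem bounds_of_mem_S (hn : 4 ≤ n) (hb2 : b ≠ 2) (h : k ∈ S n b) :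
    1 ≤ k ∧ (b - 4) / 2 ≤ k ∧ k ≤ b - 2 := by
  obtain ⟨p, -, hk, hb⟩ := (mem_S_iff hn).1 h
  have := hb.bounds hk
  refine ⟨?_, by omega, by omega⟩
  by_contra hk0
  obtain rfl : k = 0 := by omega
  exact hb2 (hb.eq_two_of_maxGap_zero hk)

/-- For odd n a single odd gap suffices, the rest being filled by 2's. For even k the value b = k +
4 would need E = 2 in `mem_S_of_odd_adjacent`, below its bound 4. -/
theorem mem_S_of_odd_order (hn : n % 2 = 1) (hb : b % 2 = 0) (hb10 : 10 ≤ b) (h : b + 5 ≤ n)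
    (h1 : b ≤ 2 * k + 4) (h2 : k + 2 ≤ b) (h3 : k + 4 ≠ b) : k ∈ S n b := by
  rcases Nat.mod_two_eq_zero_or_one k with hk | hk
  · by_cases c1 : k + 2 = b
    · exact mem_S_congr (mem_S_of_even (by omega) hk (by omega)) rfl c1
    by_cases c2 : b ≤ 2 * k + 2
    · exact mem_S_congr (mem_S_of_odd_adjacent (K := k + 1) (E := b - 2 - k) (by omega) (by omega)
        (by omega) (by omega) (by omega) (by omega) (by omega)) rfl (by omega)
    · exact mem_S_congr (mem_S_of_odd_separated (K := k + 1) (E := k) (c := 0) (by omega)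
        (by omega) hk (by omega) (by omega) (Or.inl rfl) (by omega) (by omega)) rfl (by omega)
  · by_cases c2 : b ≤ 2 * k + 2
    · exact mem_S_congr (mem_S_of_adjacent (K := k + 1) (o := b - 2 - k) (c := 0) (by omega)
        (by omega) (by omega) (by omega) (by omega) (Or.inl rfl) (by omega) (by omega)) rfl
        (by omega)
    · exact mem_S_congr (mem_S_of_separated (K := k + 1) (o := k) (c := 0) (by omega) (by omega)
        (by omega) hk (by omega) (Or.inl rfl) (by omega) (by omega)) rfl (by omega)

/-- Even order, an odd longest zero run. -/
theorem mem_S_of_odd_run (hn : n % 2 = 0) (hb : b % 2 = 0) (hk : k % 2 = 1)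
    (h2 : k + 3 ≤ b) (h1 : b ≤ 2 * k + 2) (h : 2 * b ≤ n + k + 1) : k ∈ S n b := by
  by_cases c1 : k = 1
  -- The longest gap is 2, too short for `mem_S_of_adjacent`; fillers of length 1 are used.
  · subst c1
    exact mem_S_congr (one_mem_S_four (by omega)) rfl (by omega)
  · exact mem_S_congr (mem_S_of_adjacent (K := k + 1) (o := b - 2 - k) (c := b - 2 - k) (by omega)
      (by omega) (by omega) (by omega) (by omega) (Or.inr rfl) (by omega) (by omega)) rfl
      (by omega)

theorem mem_S_of_odd_run_separated (hn : n % 2 = 0) (hb : b % 2 = 0) (hk : k % 2 = 1)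
    (h2 : k + 5 ≤ b) (h1 : b ≤ 2 * k + 4) (h : 2 * b ≤ n + k + 3) : k ∈ S n b :=
  mem_S_congr (mem_S_of_separated (K := k + 1) (o := b - 4 - k) (c := b - 4 - k) (by omega)
    (by omega) (by omega) (by omega) (by omega) (Or.inr rfl) (by omega) (by omega)) rfl (by omega)

/-- Even order, an even longest zero run. -/
theorem mem_S_of_even_run (hn : n % 2 = 0) (hb : b % 2 = 0) (hk : k % 2 = 0) (hk1 : 1 ≤ k)
    (h2 : k + 4 ≤ b) (h1 : b ≤ 2 * k + 2) (h : k + b ≤ n) : k ∈ S n b :=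
  mem_S_congr (mem_S_of_odd_between (K := k + 1) (o := b - 3 - k) (by omega) (by omega) (by omega)
    (by omega) (by omega) (by omega) hn) rfl (by omega)

theorem mem_S_of_small (hn4 : 4 ≤ n) (hn : n % 2 = 0) (hb : b % 2 = 0) (hbn : b + 1 ≤ n)
    (hk1 : 1 ≤ k) (h1 : b ≤ 2 * k + 4) (h2 : k + 2 ≤ b) (h : 3 * k + 5 ≤ n) : k ∈ S n b := by
  rcases Nat.mod_two_eq_zero_or_one k with hk | hk
  · by_cases c1 : k + 2 = b
    · exact mem_S_congr (mem_S_of_even hn4 hk (by omega)) rfl c1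
    by_cases c2 : b ≤ 2 * k + 2
    · exact mem_S_of_even_run hn hb hk hk1 (by omega) c2 (by omega)
    · exact mem_S_congr (mem_S_of_odd_separated (K := k + 1) (E := k) (c := k + 1) hn4
        (by omega) hk (by omega) (by omega) (Or.inr rfl) (by omega) (by omega)) rfl (by omega)
  · by_cases c2 : b ≤ 2 * k + 2
    · exact mem_S_of_odd_run hn hb hk (by omega) c2 (by omega)
    · exact mem_S_of_odd_run_separated hn hb hk (by omega) h1 (by omega)

theorem mem_S_iff_le_ell (hn4 : 4 ≤ n) (hn : n % 2 = 0) (hb : b % 2 = 0) (hbn : b + 1 ≤ n)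
    (hk : k % 2 = 1) (h1 : b ≤ 2 * k + 4) (h2 : k + 2 ≤ b) (h : n ≤ 3 * k + 4) :
    k ∈ S n b ↔ b ≤ ell n k := by
  constructor
  · intro hmem
    obtain ⟨p, hf, hmax, hexp⟩ := (mem_S_iff hn4).1 hmem
    exact hexp.le_ell hf hmax hn hk
  · intro hle
    unfold ell at hle
    by_cases c : 2 * b ≤ n + k + 1
    · exact mem_S_of_odd_run hn hb hk (by omega) (by split_ifs at hle <;> omega) c
    · exact mem_S_of_odd_run_separated hn hb hk (by split_ifs at hle <;> omega) h1
        (by split_ifs at hle <;> omega)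

/-- For b ≠ k + 2 the listed alternatives amount to k + b ≤ n together with b ≤ 2k + 2. -/
theorem mem_S_iff_of_even_run (hn4 : 4 ≤ n) (hn : n % 2 = 0) (hb : b % 2 = 0) (hbn : b + 1 ≤ n)
    (hk : k % 2 = 0) (hk1 : 1 ≤ k) (h2 : k + 2 ≤ b) (h : n ≤ 3 * k + 4) :
    k ∈ S n b ↔ k = b - 2 ∨ (k + b ≤ n ∧ 2 * k + 4 ≤ n ∧ n ≤ 3 * k + 2) ∨
      (n = 3 * k + 4 ∧ 3 * b ≤ 2 * (n - 1)) := by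
  constructor
  · intro hmem
    obtain ⟨p, hf, hmax, hexp⟩ := (mem_S_iff hn4).1 hmem
    by_cases c : b = k + 2
    · left; omega
    · have := hexp.of_odd_maxGap hf hmax hn hk (by omega) c
      omega
  · intro hc
    by_cases c1 : k + 2 = b
    · exact mem_S_congr (mem_S_of_even hn4 hk (by omega)) rfl c1
    · exact mem_S_of_even_run hn hb hk hk1 (by omega) (by omega) (by omega)

end Main

end SymCompanion

open Classical in
theorem mainTheorem12 (n b : ℕ) (hn : 4 ≤ n)
    (hb : b ∈ SymCompanion.exponentSet (SymCompanion.PSC n 1 0) \ {2}) :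
    -- the a priori range, and the upper bound for the number of matrices with exponent `b`
    (∀ k ∈ SymCompanion.S n b, 1 ≤ k ∧ (b - 4) / 2 ≤ k ∧ k ≤ b - 2) ∧
    SymCompanion.N n b ≤
      2 * ∑ k ∈ (Finset.Icc ((b - 4) / 2) (b - 2)).filter (fun k => k ∈ SymCompanion.S n b),
        ∑ q ∈ Finset.Icc k (n - 3), (SymCompanion.BinStr (n - 3) q k).ncard ∧
    -- part 1
    b - 2 ∈ SymCompanion.S n b ∧
    -- part 2
    (Odd n → b + 5 ≤ n → n ≤ 2 * b - 5 →
      SymCompanion.S n b = Set.Icc ((b - 4) / 2) (b - 2) \ {b - 4}) ∧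
    -- part 3
    (Even n → ∀ k : ℕ, 1 ≤ k → (b - 4) / 2 ≤ k → k ≤ b - 2 →
      (k + 2 ≤ (n + 1) / 3 → k ∈ SymCompanion.S n b) ∧
      ((n + 1) / 3 ≤ k + 1 → Odd k →
        (k ∈ SymCompanion.S n b ↔ b ≤ SymCompanion.ell n k)) ∧
      ((n + 1) / 3 ≤ k + 1 → Even k →
        (k ∈ SymCompanion.S n b ↔
          k = b - 2 ∨
          (k + b ≤ n ∧ 2 * k + 4 ≤ n ∧ n ≤ 3 * k + 2) ∨
          (n = 3 * k + 4 ∧ 3 * b ≤ 2 * (n - 1))))) := by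
  obtain ⟨⟨B, hB, -, hexp⟩, hb2⟩ := hb
  rw [Set.mem_singleton_iff] at hb2
  obtain ⟨k₀, hk₀⟩ := SymCompanion.exists_mem_S hn hB
  rw [hexp] at hk₀
  obtain ⟨p, hf, hmax, hbp⟩ := (SymCompanion.mem_S_iff hn).1 hk₀
  have heven := hbp.even
  have hbn := hbp.lt_order hf
  have hrange : ∀ k ∈ SymCompanion.S n b, 1 ≤ k ∧ (b - 4) / 2 ≤ k ∧ k ≤ b - 2 :=
    fun k hk => SymCompanion.bounds_of_mem_S hn hb2 hk
  -- This gives b ≥ 3, hence b ≥ 4 by evenness, so `(b - 4) / 2` is exact.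
  have h0 := hrange k₀ hk₀
  refine ⟨hrange, SymCompanion.N_le hn _ fun k hk => ?_, ?_, fun hodd h1 h2 => ?_,
    fun hn2 k hk1 hk2 hk3 => ⟨fun h => ?_, fun h hk => ?_, fun h hk => ?_⟩⟩
  · have := hrange k hk
    exact Finset.mem_filter.2 ⟨Finset.mem_Icc.2 ⟨this.2.1, this.2.2⟩, hk⟩
  · exact SymCompanion.mem_S_congr
      (SymCompanion.mem_S_of_even (k := b - 2) hn (by omega) (by omega)) rfl (by omega)
  · rw [Nat.odd_iff] at hodd
    ext k
    simp only [Set.mem_sdiff, Set.mem_Icc, Set.mem_singleton_iff]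
    constructor
    · intro hk
      have := hrange k hk
      obtain ⟨p, hf, hmax, hbp⟩ := (SymCompanion.mem_S_iff hn).1 hk
      have := hbp.ne_add_four hf hmax h1 h2
      omega
    · rintro ⟨⟨h3, h4⟩, h5⟩
      exact SymCompanion.mem_S_of_odd_order hodd heven (by omega) h1 (by omega) (by omega)
        (by omega)
  · rw [Nat.even_iff] at hn2
    -- The floor condition reads 3k + 5 ≤ n; its negation, used below, is n ≤ 3k + 4.
    exact SymCompanion.mem_S_of_small hn hn2 heven hbn hk1 (by omega) (by omega) (by omega)
  · rw [Nat.even_iff] at hn2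
    rw [Nat.odd_iff] at hk
    exact SymCompanion.mem_S_iff_le_ell hn hn2 heven hbn hk (by omega) (by omega) (by omega)
  · rw [Nat.even_iff] at hn2 hk
    exact SymCompanion.mem_S_iff_of_even_run hn hn2 heven hbn hk hk1 (by omega) (by omega)
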